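/- Fix an integer $k\ge 1$; $\log$ is to base 2. A $k$-substring edit $x\to y$ of a binary string $x$ replaces a (possibly empty) substring $u$ of $x$ by a string $v$, where $|u|,|v|\le k$. A set $D$ of binary strings corrects one $k$-substring edit if $x,x'\in D$, $x\to y$ and $x'\to y$ imply $x=x'$; the redundancy of a code $D\subseteq\{0,1\}^n$ is $n-\log|D|$. Cut a binary string $x$ immediately before each occurrence of the pattern $0^k1^k$, which gives the parts $x_1,\dots,x_{n_{\mathcal P}(x)}$ ($x_1$ starts at the first bit of $x$ and is empty if $x$ starts with the pattern). For real $\delta$, $x$ is $(\mathcal P,\delta)$-dense if all its parts have length at most $\delta$. Let $B=3\cdot 2^k$, $C=40k2^k$, and $f(u)=d(u)+B\,n_{1^k}(u)+C|u|$ for a binary string $u$, where $n_{1^k}(u)$ is the number of (possibly overlapping) occurrences of $1^k$ in $u$, and $d(u)\in[0,2^k-1]$ has as its $j$-th binary digit (most significant first, $1\le j\le k$) the parity of $\sum_{i\equiv j \bmod k}u_i$. For $x\in\{0,1\}^n$ let $$h(x)=\Big(\sum_{i} i\,f(x_i)\bmod 2000Cn,\ \ \sum_{i} f(x_i)\bmod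 10Ck,\ \ n_{\mathcal P}(x)\bmod 5\Big),$$ the sums running over $1\le i\le n_{\mathcal P}(x)$. Let $\phi_A:\{0,1\}^A\to\{0,1\}^{m(A)}$, $A\in\mathbb N$, be hashes with $m(A)\le 4k\log A+o(\log A)$ that correct one $k$-substring edit: if $r,r'\in\{0,1\}^A$, $r\to s$, $r'\to s$ and $\phi_A(r)=\phi_A(r')$, then $r=r'$. Cut $x$ into consecutive blocks of length $A$ (the last one padded by zeros), and let $\psi_A(x)$ be the pair consisting of the sum of the hash values (read as integers) of the odd-numbered blocks and that of the even-numbered blocks, both modulo $2^{m(A)}$. For values $c_1,c_2$ let $$\mathcal C=\{x\in\{0,1\}^n:\ x\text{ is }(\mathcal P,\delta)\text{-dense},\ h(x)=c_1,\ \psi_A(x)=c_2\}.$$ **Theorem.** Such hashes $\phi_A$ exist, and there is a constant $K_0>0$ depending only on $k$ such that, for every such family $(\phi_A)$: 1. For all $n$, $\delta$, $c_1$, $c_2$ and all $A\ge K_0\delta^2$, the code $\mathcal C$ corrects one $k$-substring edit. 2. Let $\delta=\delta_n=k2^{2k+3}\log n$, and let $A=A_n\ge K_0\delta_n^2$ for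 all $n$, with $A_n=O(\delta_n^2)$. Then for each $n$ there are values $c_1,c_2$ for which, as $n\to\infty$, $\mathcal C$ has redundancy $\log n+O(\log\log n)$. This is asymptotically optimal: if $\rho_n$ is the smallest redundancy of a nonempty code in $\{0,1\}^n$ that corrects one $k$-substring edit, then the redundancy of $\mathcal C$ exceeds $\rho_n$ by at most $O(\log\log n)$, and their ratio tends to $1$. -/

import Mathlib

open Filter Asymptotics

namespace EditCode

/-- `SubstringEdit k x y`: the string `y` arises from `x` by one `k`-substring edit, i.e. by replacing
a (possibly empty) substring `u` of length at most `k` by a string `v` of length at most `k`. -/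
def SubstringEdit (k : ℕ) (x y : List Bool) : Prop :=
  ∃ a u v b : List Bool,
    u.length ≤ k ∧ v.length ≤ k ∧ x = a ++ u ++ b ∧ y = a ++ v ++ b

/-- A code (a set of binary strings) corrects one `k`-substring edit if every received string
arises from at most one codeword. -/
def Corrects (k : ℕ) (D : Set (List Bool)) : Prop :=
  ∀ x ∈ D, ∀ x' ∈ D, ∀ y, SubstringEdit k x y → SubstringEdit k x' y → x = x'

/-- The pattern `0^k 1^k`. -/
def pattern (k : ℕ) : List Bool :=
  List.replicate k false ++ List.replicate k true

/-- The parts `x_1, x_2, …` of `x`: the string is cut immediately before every occurrence of the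
pattern. The first part starts at the beginning of `x`; it is empty if `x` starts with the
pattern (or is empty). The fallback `[]` in the first case is never reached. -/
def parts (k : ℕ) : List Bool → List (List Bool)
  | [] => [[]]
  | c :: t =>
    match parts k t with
    | [] => []
    | q :: qs =>
      if pattern k <+: c :: t then [] :: (c :: q) :: qs else (c :: q) :: qs

/-- `x` is dense with parameter `δ`: all its parts have length at most `δ`. -/
def Dense (k : ℕ) (δ : ℝ) (x : List Bool) : Prop :=
  ∀ q ∈ parts k x, (q.length : ℝ) ≤ δ

/-- The `k` parities of the bits of `x` along the residue classes of the positions modulo `k`, read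
as a binary number whose most significant bit belongs to the class of the first position. -/
def d (k : ℕ) (x : List Bool) : ℕ :=
  ∑ j ∈ Finset.range k,
    ((∑ i ∈ Finset.range x.length with i % k = j, (x.getD i false).toNat) % 2) * 2 ^ (k - 1 - j)

/-- The number of (possibly overlapping) occurrences of `1^k` in `x`. -/
def numOnes (k : ℕ) (x : List Bool) : ℕ :=
  ((Finset.range x.length).filter (fun i => List.replicate k true <+: x.drop i)).card

/-- The constant `B = 3 · 2^k`. -/
def B (k : ℕ) : ℕ := 3 * 2 ^ k

/-- The constant `C = 40 k 2^k`. -/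
def C (k : ℕ) : ℕ := 40 * k * 2 ^ k

/-- `f(x) = d(x) + B n_{1^k}(x) + C |x|`. -/
def f (k : ℕ) (x : List Bool) : ℕ :=
  d k x + B k * numOnes k x + C k * x.length

/-- The integer string obtained by applying `f` to every part of `x`. -/
def fString (k : ℕ) (x : List Bool) : List ℕ :=
  (parts k x).map (f k)

/-- The VT sketch `∑ i z_i` (positions counted from `1`). -/
def VT (z : List ℕ) : ℕ :=
  ∑ i ∈ Finset.range z.length, (i + 1) * z.getD i 0

/-- The hash `h` for strings of length `n`. -/
def h (k n : ℕ) (x : List Bool) : ℕ × ℕ × ℕ :=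
  (VT (fString k x) % (2000 * C k * n),
    (fString k x).sum % (10 * C k * k),
    (parts k x).length % 5)

/-- `φ` is a family of hashes `φ_A : {0,1}^A → {0,1}^{m A}` that correct a single `k`-substring edit
(`r` is determined by `φ_A r` and any `s` arising from `r` by an edit), with
`m A ≤ 4 k log A + o(log A)`. Hash values are bit strings read as integers in `[0, 2^{m A})`;
only the values of `φ A` on strings of length `A` matter. -/
structure IsEditHash (k : ℕ) (m : ℕ → ℕ) (φ : ℕ → List Bool → ℕ) : Prop where
  lt_two_pow : ∀ (A : ℕ) (r : List Bool), r.length = A → φ A r < 2 ^ m A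
  corrects : ∀ (A : ℕ) (r r' s : List Bool), r.length = A → r'.length = A →
    SubstringEdit k r s → SubstringEdit k r' s → φ A r = φ A r' → r = r'
  size : ∃ e : ℕ → ℝ, (e =o[atTop] fun A : ℕ => Real.logb 2 (A : ℝ)) ∧
    ∀ A : ℕ, (m A : ℝ) ≤ 4 * k * Real.logb 2 (A : ℝ) + e A

/-- The `i`-th (counted from `0`) of the consecutive blocks of length `A` of `x`; the last block is
padded by zeros to length `A`. -/
def block (A : ℕ) (x : List Bool) (i : ℕ) : List Bool :=
  ((x.drop (i * A)).take A).rightpad A false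

/-- The number `⌈|x| / A⌉` of blocks of length `A`. -/
def numBlocks (A : ℕ) (x : List Bool) : ℕ :=
  (x.length + A - 1) / A

/-- The block hash `ψ_A`: the sums of the hashes of the blocks with odd number and of the blocks
with even number (numbers counted from `1`), both modulo `2^{m A}`. -/
def psi (m : ℕ → ℕ) (φ : ℕ → List Bool → ℕ) (A : ℕ) (x : List Bool) : ℕ × ℕ :=
  ((∑ i ∈ Finset.range (numBlocks A x) with Odd (i + 1), φ A (block A x i)) % 2 ^ m A,
    (∑ i ∈ Finset.range (numBlocks A x) with Even (i + 1), φ A (block A x i)) % 2 ^ m A)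

/-- The code of length `n`: the dense strings with prescribed values of `h` and `ψ_A`. -/
def code (k n : ℕ) (δ : ℝ) (m : ℕ → ℕ) (φ : ℕ → List Bool → ℕ) (A : ℕ)
    (c₁ : ℕ × ℕ × ℕ) (c₂ : ℕ × ℕ) : Set (List Bool) :=
  {x | x.length = n ∧ Dense k δ x ∧ h k n x = c₁ ∧ psi m φ A x = c₂}

/-- The redundancy `n - log₂ |D|` of a code `D` of length `n`. -/
noncomputable def redundancy (n : ℕ) (D : Set (List Bool)) : ℝ :=
  (n : ℝ) - Real.logb 2 (D.ncard : ℝ)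

/-- The smallest redundancy of a nonempty code of length `n` that corrects one `k`-substring
edit. -/
noncomputable def optRedundancy (k n : ℕ) : ℝ :=
  sInf {r : ℝ | ∃ D : Set (List Bool), D.Nonempty ∧ (∀ x ∈ D, x.length = n) ∧
    Corrects k D ∧ r = redundancy n D}

/-- The density parameter `δ = k 2^{2k+3} log₂ n`. -/
noncomputable def delta (k n : ℕ) : ℝ :=
  (k : ℝ) * 2 ^ (2 * k + 3) * Real.logb 2 (n : ℝ)

end EditCode

namespace EditCode

/-! Correction. Suppose dense strings `x ≠ x'` have equal hashes and a common descendant `y`.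
Occurrences of `0^k1^k` never overlap, so an edit turns a run `M` of at most three parts into a run
`M'` of at most three and leaves the other parts alone (`exists_parts_edit`). The sum of `f` over
this run moves by less than `D = 2kC`. If neither this sum nor the number of parts moves, the edit
did nothing (`exists_parts_of_edit`): in mixed radix the sum of `f` reveals the total length, the
number of `1^k` and the sum of `d`. An equal-length edit that moves a cut changes the number of
`1^k`, and when no cut moves, the parities `d` determine the edited bits.

If the two edits touch disjoint runs of `y`, the parts are `P M R N' S'` for `x`, `P M' R N S'` for
`x'` and `P M' R N' S'` for `y`, up to exchanging `x` and `x'`. The two small components of `h`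
force equal numbers of parts and equal sums of `f`, and the VT sketches then differ by `E + t ΣR -
|R| s`, where `t = |M| - |M'|`, `s = ΣM - ΣM'` and `|E| ≤ 6 (ΣM + ΣN')`. Here `(t, s) ≠ (0, 0)`,
`|s| < D`, and each entry of `R` is at least `D`, so equality of the sketches gives `|R| ≤ |E|`
(`length_le_of_VT_modEq`). By density `|R| = O(δ)`, and `x`, `x'` differ only in a window of length
`O(δ²)` (`exists_window`). This window meets at most two adjacent blocks, one odd and one even,
whose hashes `ψ_A` recovers (`eq_of_psi_eq`).

Redundancy. At least half of all strings are dense (`two_mul_card_sparse_le`), and there are `O(n)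
2^{2m(A)}` hash values with `m(A) = O(log log n)`, so pigeonhole gives a code of redundancy at most
`log n + O(log log n)`. Sphere packing with single substitutions gives the lower bound `log (n + 1)`
for every correcting code. The hashes come from greedily colouring the confusability graph, whose
degrees are `O(A²)`. -/

lemma pattern_length (k : ℕ) : (pattern k).length = 2 * k := by
  simp [pattern]; ring

/-! ### Occurrences in a concatenation -/

/-- The number of (possibly overlapping) occurrences of `w` in `x`. -/
def occ (w x : List Bool) : ℕ :=
  ((Finset.range x.length).filter (fun i => w <+: x.drop i)).card

lemma occ_nil (w : List Bool) : occ w [] = 0 := by simp [occ]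

lemma occ_cons (w : List Bool) (c : Bool) (t : List Bool) :
    occ w (c :: t) = (if w <+: c :: t then 1 else 0) + occ w t := by
  simp only [occ, Finset.card_filter, List.length_cons, Finset.sum_range_succ', List.drop_succ_cons,
    List.drop_zero]
  ring

lemma occ_le_length (w x : List Bool) : occ w x ≤ x.length := by
  simpa [occ] using Finset.card_filter_le (Finset.range x.length) (fun i => w <+: x.drop i)

lemma occ_eq_zero_of_length_lt {w x : List Bool} (hx : x.length < w.length) : occ w x = 0 := by
  simp only [occ, Finset.card_eq_zero, Finset.filter_eq_empty_iff]
  intro i _ hp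
  have := hp.length_le
  simp at this
  omega

lemma prefix_append_iff {w s t : List Bool} (hs : w.length ≤ s.length) :
    w <+: s ++ t ↔ w <+: s :=
  ⟨fun hp => List.prefix_of_prefix_length_le hp (List.prefix_append s t) hs,
    fun hp => hp.trans (List.prefix_append s t)⟩

lemma le_occ_append (w s t : List Bool) : occ w s + occ w t ≤ occ w (s ++ t) := by
  induction s with
  | nil => simp [occ_nil]
  | cons c s ih =>
    rw [List.cons_append, occ_cons, occ_cons]
    by_cases hp : w <+: c :: s
    · have : w <+: c :: (s ++ t) := hp.trans (List.prefix_append (c :: s) t)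
      simp only [hp, this, if_true]
      omega
    · simp only [hp, if_false]
      omega

lemma occ_append_le (w s t : List Bool) :
    occ w (s ++ t) ≤ occ w s + occ w t + min s.length w.length := by
  induction s with
  | nil => simp [occ_nil]
  | cons c s ih =>
    rw [List.cons_append, occ_cons, occ_cons]
    by_cases hl : w.length ≤ (c :: s).length
    · have := prefix_append_iff (t := t) hl
      rw [List.cons_append] at this
      simp only [this, List.length_cons]
      omega
    · simp only [List.length_cons] at hl ⊢
      split_ifs <;> omega

lemma ones_prefix_iff {k : ℕ} {x : List Bool} {i : ℕ} :
    List.replicate k true <+: x.drop i ↔ ∀ j < k, x.getD (i + j) false = true := by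
  rw [List.prefix_iff_getElem?]
  simp only [List.length_replicate, List.getElem_replicate, List.getElem?_drop, List.getD]
  refine forall₂_congr fun j _ => ?_
  cases x[i + j]? <;> simp

lemma pattern_prefix_iff {k : ℕ} (hk : 1 ≤ k) {x : List Bool} {i : ℕ} :
    pattern k <+: x.drop i ↔
      (∀ j < k, x.getD (i + j) false = false) ∧ ∀ j < k, x.getD (i + k + j) false = true := by
  rw [List.prefix_iff_getElem?]
  simp only [List.getElem?_drop, pattern_length]
  constructor
  · intro hp
    refine ⟨fun j hj => ?_, fun j hj => ?_⟩
    · have := hp j (by omega)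
      simp [pattern, hj] at this
      simp [List.getD, this]
    · have := hp (k + j) (by omega)
      simp [pattern] at this
      simp [List.getD, add_assoc, this]
  · rintro ⟨h0, h1⟩ j hj
    have hlen : i + k + (k - 1) < x.length := by
      by_contra hlt
      have := h1 (k - 1) (by omega)
      rw [List.getD_eq_default _ _ (by omega)] at this
      simp at this
    by_cases hjk : j < k
    · have := h0 j hjk
      rw [List.getD_eq_getElem _ _ (by omega)] at this
      simp [pattern, hjk, this,
        List.getElem?_eq_getElem (show i + j < x.length by omega)]
    · have := h1 (j - k) (by omega)
      rw [show i + k + (j - k) = i + j by omega, List.getD_eq_getElem _ _ (by omega)] at this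
      simp [pattern, List.getElem_append, hjk, this,
        List.getElem?_eq_getElem (show i + j < x.length by omega)]

/-- A shift by less than `2k` puts a one of the earlier occurrence on a zero of the later one. -/
lemma pattern_not_overlap {k : ℕ} (hk : 1 ≤ k) {x : List Bool} {i j : ℕ}
    (hi : pattern k <+: x.drop i) (hj : pattern k <+: x.drop j) (hij : i < j) : i + 2 * k ≤ j := by
  rw [pattern_prefix_iff hk] at hi hj
  by_contra hlt
  by_cases hjk : j < i + k
  · have h1 := hi.2 0 (by omega)
    have h2 := hj.1 (i + k - j) (by omega)
    rw [show j + (i + k - j) = i + k + 0 by omega, h1] at h2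
    simp at h2
  · have h1 := hi.2 (j - (i + k)) (by omega)
    have h2 := hj.1 0 (by omega)
    rw [show i + k + (j - (i + k)) = j + 0 by omega, h2] at h1
    simp at h1

lemma occ_pattern_append_le {k : ℕ} (hk : 1 ≤ k) (s t : List Bool) :
    occ (pattern k) (s ++ t) ≤ occ (pattern k) s + occ (pattern k) t + 1 := by
  -- Only an occurrence straddling the junction is new. The indicator records whether there is one;
  -- by non-overlap a second can never be added during the induction.
  have key : occ (pattern k) (s ++ t) ≤ occ (pattern k) s + occ (pattern k) t +
      if ∃ i < s.length, s.length < i + 2 * k ∧ pattern k <+: (s ++ t).drop i then 1 else 0 := by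
    induction s with
    | nil => simp [occ_nil]
    | cons c s ih =>
      rw [List.cons_append, occ_cons, occ_cons]
      have hstep : (∃ i < s.length, s.length < i + 2 * k ∧ pattern k <+: (s ++ t).drop i) →
          ∃ i < (c :: s).length, (c :: s).length < i + 2 * k ∧
            pattern k <+: (c :: (s ++ t)).drop i := by
        rintro ⟨i, h1, h2, h3⟩
        exact ⟨i + 1, by simpa using h1, by simp; omega, by simpa using h3⟩
      by_cases hl : 2 * k ≤ (c :: s).length
      · have := prefix_append_iff (w := pattern k) (s := c :: s) (t := t)
          (by rwa [pattern_length])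
        rw [List.cons_append] at this
        simp only [this]
        split_ifs at ih ⊢ <;> first | omega | (exfalso; simp_all)
      · by_cases hp : pattern k <+: c :: (s ++ t)
        · have hno : ¬ ∃ i < s.length, s.length < i + 2 * k ∧ pattern k <+: (s ++ t).drop i := by
            rintro ⟨i, h1, h2, h3⟩
            have := pattern_not_overlap hk (x := c :: (s ++ t)) (i := 0) (j := i + 1)
              (by simpa using hp) (by simpa using h3) (by omega)
            simp at hl
            omega
          have hyes : ∃ i < (c :: s).length, (c :: s).length < i + 2 * k ∧
            pattern k <+: (c :: (s ++ t)).drop i := ⟨0, by simp, by omega, by simpa using hp⟩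
          rw [if_neg hno] at ih
          rw [if_pos hp, if_pos hyes]
          omega
        · rw [if_neg hp]
          by_cases hh : ∃ i < s.length, s.length < i + 2 * k ∧ pattern k <+: (s ++ t).drop i
          · rw [if_pos hh] at ih
            rw [if_pos (hstep hh)]
            omega
          · rw [if_neg hh] at ih
            omega
  refine key.trans ?_
  split_ifs <;> omega

/-! ### Parts -/

lemma parts_ne_nil (k : ℕ) (x : List Bool) : parts k x ≠ [] := by
  induction x with
  | nil => simp [parts]
  | cons c t ih =>
    rw [parts]
    split
    · contradiction
    · split_ifs <;> simp

lemma parts_cons {k : ℕ} {c : Bool} {t q : List Bool} {qs : List (List Bool)}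
    (ht : parts k t = q :: qs) :
    parts k (c :: t) = if pattern k <+: c :: t then [] :: (c :: q) :: qs else (c :: q) :: qs := by
  rw [parts, ht]

lemma flatten_parts (k : ℕ) (x : List Bool) : (parts k x).flatten = x := by
  induction x with
  | nil => simp [parts]
  | cons c t ih =>
    obtain ⟨q, qs, hq⟩ := List.exists_cons_of_ne_nil (parts_ne_nil k t)
    rw [parts_cons hq]
    rw [hq] at ih
    split_ifs <;> simp_all

lemma length_parts (k : ℕ) (x : List Bool) : (parts k x).length = 1 + occ (pattern k) x := by
  induction x with
  | nil => simp [parts, occ_nil]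
  | cons c t ih =>
    obtain ⟨q, qs, hq⟩ := List.exists_cons_of_ne_nil (parts_ne_nil k t)
    rw [parts_cons hq, occ_cons]
    rw [hq] at ih
    simp at ih
    split_ifs <;> simp <;> omega

/-- Adding a prefix `u` changes only the first part. -/
lemma parts_append_right {k : ℕ} {b q : List Bool} {S : List (List Bool)} (hb : parts k b = q :: S)
    (u : List Bool) : ∃ m M, parts k (u ++ b) = m :: M ++ S ∧ (m :: M).flatten = u ++ q := by
  induction u with
  | nil => exact ⟨q, [], by simpa using hb, by simp⟩
  | cons c u ih =>
    obtain ⟨m, M, h1, h2⟩ := ih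
    rw [List.cons_append, parts_cons h1]
    split_ifs
    · exact ⟨[], (c :: m) :: M, by simp, by simpa using h2⟩
    · exact ⟨c :: m, M, by simp, by simpa using h2⟩

/-- A cut inside `a` or `b` survives. A new cut cannot precede the last cut of `a`, since an
occurrence starting there would end inside `a`. Hence only the last part of `a`, `u` and the first
part of `b` are recut. -/
lemma exists_parts_append (k : ℕ) {b q : List Bool} {S : List (List Bool)}
    (hb : parts k b = q :: S) (u : List Bool) (a : List Bool) :
    ∀ P p, parts k a = P ++ [p] →
    ∃ m M, parts k (a ++ (u ++ b)) = P ++ (m :: M) ++ S ∧ (m :: M).flatten = p ++ (u ++ q) := by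
  induction a with
  | nil =>
    intro P p ha
    have : P = [] ∧ p = [] := by
      rw [parts] at ha
      cases P with
      | nil => simpa using ha.symm
      | cons _ _ => simp at ha
    obtain ⟨rfl, rfl⟩ := this
    simpa using parts_append_right hb u
  | cons c a ih =>
    intro P p ha
    obtain ⟨P', p', ha'⟩ : ∃ P' p', parts k a = P' ++ [p'] :=
      ⟨_, _, (List.dropLast_append_getLast (parts_ne_nil k a)).symm⟩
    obtain ⟨m, M, h1, h2⟩ := ih P' p' ha'
    cases P' with
    | nil =>
      rw [List.nil_append] at h1
      have hx := parts_cons (c := c) (show parts k (a ++ (u ++ b)) = m :: (M ++ S) by simpa using h1)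
      have hx' := parts_cons (c := c) (show parts k a = p' :: [] by simpa using ha')
      rw [ha] at hx'
      by_cases hp : pattern k <+: c :: a
      · have hp' : pattern k <+: c :: (a ++ (u ++ b)) :=
          hp.trans (List.prefix_append (c :: a) (u ++ b))
        rw [if_pos hp] at hx'
        rw [if_pos hp'] at hx
        have : P = [[]] ∧ p = c :: p' := by
          have := List.append_inj' (s₁ := P) (s₂ := [[]]) (t₁ := [p]) (t₂ := [c :: p'])
            (by simpa using hx') rfl
          simpa using this
        obtain ⟨rfl, rfl⟩ := this
        exact ⟨c :: m, M, by simpa using hx, by simpa using h2⟩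
      · rw [if_neg hp] at hx'
        have : P = [] ∧ p = c :: p' := by
          have := List.append_inj' (s₁ := P) (s₂ := []) (t₁ := [p]) (t₂ := [c :: p'])
            (by simpa using hx') rfl
          simpa using this
        obtain ⟨rfl, rfl⟩ := this
        by_cases hp' : pattern k <+: c :: (a ++ (u ++ b))
        · rw [if_pos hp'] at hx
          exact ⟨[], (c :: m) :: M, by simpa using hx, by simpa using h2⟩
        · rw [if_neg hp'] at hx
          exact ⟨c :: m, M, by simpa using hx, by simpa using h2⟩
    | cons q' P' =>
      -- Since `a` is cut somewhere, it is long enough that `c :: a` alone decides whether the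
      -- pattern starts at `c`.
      have hlen : (pattern k).length ≤ (c :: a).length := by
        by_contra hlt
        have h0 : occ (pattern k) a = 0 := occ_eq_zero_of_length_lt (by simp at hlt ⊢; omega)
        have := length_parts k a
        rw [ha', h0] at this
        simp at this
      have hpp := prefix_append_iff (t := u ++ b) hlen
      rw [List.cons_append] at hpp
      have hx := parts_cons (c := c)
        (show parts k (a ++ (u ++ b)) = q' :: (P' ++ (m :: M) ++ S) by simpa using h1)
      have hx' := parts_cons (c := c) (show parts k a = q' :: (P' ++ [p']) by simpa using ha')
      rw [ha] at hx'
      simp only [hpp] at hx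
      split_ifs at hx hx'
      · have : P = [] :: (c :: q') :: P' ∧ p = p' := by
          have := List.append_inj' (s₁ := P) (s₂ := [] :: (c :: q') :: P') (t₁ := [p]) (t₂ := [p'])
            (by simpa using hx') rfl
          simpa using this
        obtain ⟨rfl, rfl⟩ := this
        exact ⟨m, M, by simpa using hx, h2⟩
      · have : P = (c :: q') :: P' ∧ p = p' := by
          have := List.append_inj' (s₁ := P) (s₂ := (c :: q') :: P') (t₁ := [p]) (t₂ := [p'])
            (by simpa using hx') rfl
          simpa using this
        obtain ⟨rfl, rfl⟩ := this
        exact ⟨m, M, by simpa using hx, h2⟩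

/-- An edit affects at most three consecutive parts. -/
lemma exists_parts_edit {k : ℕ} (hk : 1 ≤ k) (a b : List Bool) :
    ∃ P p q S, ∀ u : List Bool, u.length ≤ k → ∃ m M, parts k (a ++ u ++ b) = P ++ (m :: M) ++ S ∧
      (m :: M).flatten = p ++ u ++ q ∧ M.length ≤ 2 := by
  obtain ⟨P, p, ha⟩ : ∃ P p, parts k a = P ++ [p] :=
    ⟨_, _, (List.dropLast_append_getLast (parts_ne_nil k a)).symm⟩
  obtain ⟨q, S, hb⟩ := List.exists_cons_of_ne_nil (parts_ne_nil k b)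
  refine ⟨P, p, q, S, fun u hu => ?_⟩
  obtain ⟨m, M, h1, h2⟩ := exists_parts_append k hb u a P p ha
  refine ⟨m, M, by simpa using h1, by simpa using h2, ?_⟩
  have l1 := length_parts k (a ++ (u ++ b))
  have l2 := length_parts k a
  have l3 := length_parts k b
  rw [h1] at l1
  rw [ha] at l2
  rw [hb] at l3
  -- `u` is too short to contain the pattern and each of its two ends creates at most one
  -- occurrence, hence at most two extra cuts.
  have o1 := occ_pattern_append_le hk a (u ++ b)
  have o2 := occ_pattern_append_le hk u b
  have o3 : occ (pattern k) u = 0 := occ_eq_zero_of_length_lt (by rw [pattern_length]; omega)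
  simp at l1 l2 l3
  omega

lemma le_length_first_part {k : ℕ} : ∀ {t q : List Bool} {qs : List (List Bool)} {l : ℕ},
    parts k t = q :: qs → l ≤ t.length → (∀ i < l, ¬ pattern k <+: t.drop i) → l ≤ q.length := by
  intro t
  induction t with
  | nil => intro q qs l _ hl _; simp at hl; omega
  | cons c t ih =>
    intro q qs l hq hl hno
    cases l with
    | zero => omega
    | succ l =>
      obtain ⟨q', qs', hq'⟩ := List.exists_cons_of_ne_nil (parts_ne_nil k t)
      have := ih hq' (by simpa using hl) fun i hi => by simpa using hno (i + 1) (by omega)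
      rw [parts_cons hq', if_neg (by simpa using hno 0 (by omega))] at hq
      simp at hq
      rw [← hq.1]
      simpa using this

/-- Since occurrences do not overlap, the next cut comes only after the whole pattern that opened
the part. -/
lemma pattern_prefix_of_mem_tail {k : ℕ} (hk : 1 ≤ k) (x : List Bool) :
    ∀ q ∈ (parts k x).tail, pattern k <+: q := by
  induction x with
  | nil => simp [parts]
  | cons c t ih =>
    obtain ⟨q, qs, hq⟩ := List.exists_cons_of_ne_nil (parts_ne_nil k t)
    rw [hq] at ih
    simp at ih
    rw [parts_cons hq]
    split_ifs with hp
    · simp only [List.tail_cons, List.mem_cons, forall_eq_or_imp]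
      refine ⟨?_, ih⟩
      have hlen := hp.length_le
      rw [pattern_length, List.length_cons] at hlen
      have hql : 2 * k - 1 ≤ q.length := by
        refine le_length_first_part hq (by omega) fun i hi hpi => ?_
        have := pattern_not_overlap hk (x := c :: t) (i := 0) (j := i + 1) (by simpa using hp)
          (by simpa using hpi) (by omega)
        omega
      have hqt : c :: q <+: c :: t := by
        have := flatten_parts k t
        rw [hq, List.flatten_cons] at this
        exact ⟨qs.flatten, by rw [List.cons_append, this]⟩
      exact List.prefix_of_prefix_length_le hp hqt (by rw [pattern_length, List.length_cons]; omega)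
    · simpa using ih

/-- The part lengths depend only on the positions of the pattern. -/
lemma map_length_parts_eq {k : ℕ} : ∀ {x y : List Bool}, x.length = y.length →
    (∀ i, pattern k <+: x.drop i ↔ pattern k <+: y.drop i) →
    (parts k x).map List.length = (parts k y).map List.length := by
  intro x
  induction x with
  | nil =>
    intro y hl _
    rw [List.eq_nil_of_length_eq_zero hl.symm]
  | cons c t ih =>
    intro y hl hp
    cases y with
    | nil => simp at hl
    | cons c' t' =>
      have := ih (y := t') (by simpa using hl) fun i => by simpa using hp (i + 1)
      obtain ⟨q, qs, hq⟩ := List.exists_cons_of_ne_nil (parts_ne_nil k t)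
      obtain ⟨q', qs', hq'⟩ := List.exists_cons_of_ne_nil (parts_ne_nil k t')
      have h0 : pattern k <+: c :: t ↔ pattern k <+: c' :: t' := by simpa using hp 0
      rw [parts_cons hq, parts_cons hq']
      rw [hq, hq'] at this
      simp only [h0]
      split_ifs <;> simp_all

/-! ### Additivity of the number of `1^k` over the parts -/

lemma numOnes_eq_occ (k : ℕ) (x : List Bool) : numOnes k x = occ (List.replicate k true) x := rfl

/-- No run of ones crosses a junction followed by a zero. The default value `false` also covers
empty `t`. -/
lemma numOnes_append_of_getD {k : ℕ} (s : List Bool) {t : List Bool} (ht : t.getD 0 false = false) :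
    numOnes k (s ++ t) = numOnes k s + numOnes k t := by
  simp only [numOnes_eq_occ]
  induction s with
  | nil => simp [occ_nil]
  | cons c s ih =>
    have : List.replicate k true <+: c :: (s ++ t) ↔ List.replicate k true <+: c :: s := by
      refine ⟨fun hp => ?_, fun hp => hp.trans (List.prefix_append (c :: s) t)⟩
      by_cases hl : k ≤ (c :: s).length
      · exact (prefix_append_iff (s := c :: s) (t := t) (by simpa using hl)).1 hp
      · have h1 := (ones_prefix_iff (x := c :: s ++ t) (i := 0)).1 (by simpa using hp)
          (c :: s).length (by omega)
        rw [List.getD_append_right _ _ _ _ (by omega)] at h1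
        rw [zero_add, Nat.sub_self, ht] at h1
        simp at h1
    rw [List.cons_append, occ_cons, occ_cons, ih]
    simp only [this]
    omega

lemma getD_zero_of_pattern_prefix {k : ℕ} (hk : 1 ≤ k) {x : List Bool} (hx : pattern k <+: x) :
    x.getD 0 false = false :=
  ((pattern_prefix_iff hk (i := 0)).1 (by simpa using hx)).1 0 (by omega)

lemma numOnes_flatten {k : ℕ} (hk : 1 ≤ k) : ∀ (M : List (List Bool)) (m : List Bool),
    (∀ q ∈ M, pattern k <+: q) →
    numOnes k (m :: M).flatten = ((m :: M).map (numOnes k)).sum := by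
  intro M
  induction M with
  | nil => intro m _; simp
  | cons m' M ih =>
    intro m hM
    have h1 := ih m' fun q hq => hM q (by simp [hq])
    have h2 : ((m' :: M).flatten).getD 0 false = false := by
      refine getD_zero_of_pattern_prefix hk ((hM m' (by simp)).trans ?_)
      rw [List.flatten_cons]
      exact List.prefix_append _ _
    rw [List.flatten_cons, numOnes_append_of_getD _ h2, h1]
    simp

/-! ### The parities `d` -/

lemma d_lt (k : ℕ) (x : List Bool) : d k x < 2 ^ k := by
  have h1 : d k x ≤ ∑ j ∈ Finset.range k, 2 ^ (k - 1 - j) := by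
    refine Finset.sum_le_sum fun j _ => ?_
    have := Nat.mod_lt (∑ i ∈ Finset.range x.length with i % k = j, (x.getD i false).toNat)
      (show 2 > 0 by norm_num)
    nlinarith [Nat.one_le_two_pow (n := k - 1 - j)]
  rw [Finset.sum_range_reflect (fun i => 2 ^ i) k, Nat.geomSum_eq (by norm_num)] at h1
  have := Nat.one_le_two_pow (n := k)
  simp at h1
  omega

lemma binary_digits_unique : ∀ (k : ℕ) (a b : ℕ → ℕ), (∀ j, a j < 2) → (∀ j, b j < 2) →
    ∑ j ∈ Finset.range k, a j * 2 ^ j = ∑ j ∈ Finset.range k, b j * 2 ^ j →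
    ∀ j < k, a j = b j := by
  intro k
  induction k with
  | zero => intro a b _ _ _ j hj; omega
  | succ k ih =>
    intro a b ha hb hab j hj
    rw [Finset.sum_range_succ', Finset.sum_range_succ'] at hab
    simp only [pow_succ, ← mul_assoc, ← Finset.sum_mul] at hab
    have h1 := ha 0
    have h2 := hb 0
    cases j with
    | zero => omega
    | succ j =>
      exact ih (fun j => a (j + 1)) (fun j => b (j + 1)) (fun j => ha _) (fun j => hb _)
        (by omega) j (by omega)

lemma parity_eq_of_d_eq {k : ℕ} {x y : List Bool} (hd : d k x = d k y) {j : ℕ} (hj : j < k) :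
    (∑ i ∈ Finset.range x.length with i % k = j, (x.getD i false).toNat) % 2 =
      (∑ i ∈ Finset.range y.length with i % k = j, (y.getD i false).toNat) % 2 := by
  let p (x : List Bool) (j : ℕ) : ℕ :=
    (∑ i ∈ Finset.range x.length with i % k = j, (x.getD i false).toNat) % 2
  have hr : ∀ x, d k x = ∑ j ∈ Finset.range k, p x (k - 1 - j) * 2 ^ j := by
    intro x
    rw [← Finset.sum_range_reflect]
    refine Finset.sum_congr rfl fun j hj => ?_
    rw [Finset.mem_range] at hj
    rw [show k - 1 - (k - 1 - j) = j by omega]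
  rw [hr, hr] at hd
  have := binary_digits_unique k _ _ (fun j => Nat.mod_lt _ (by norm_num))
    (fun j => Nat.mod_lt _ (by norm_num)) hd (k - 1 - j) (by omega)
  simp only [show k - 1 - (k - 1 - j) = j by omega] at this
  exact this

lemma getD_window {a u v b : List Bool} (huv : u.length = v.length) {i : ℕ}
    (hi : i < a.length ∨ a.length + u.length ≤ i) :
    (a ++ u ++ b).getD i false = (a ++ v ++ b).getD i false := by
  rcases hi with hi | hi
  · rw [List.append_assoc, List.append_assoc, List.getD_append _ _ _ _ hi,
      List.getD_append _ _ _ _ hi]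
  · rw [List.getD_append_right _ _ _ _ (by simpa using hi),
      List.getD_append_right _ _ _ _ (by simpa [← huv] using hi)]
    simp [huv]

/-- At most `k` consecutive positions lie in distinct classes modulo `k`, so each parity sees at
most one bit of the window. -/
lemma eq_of_d_eq {k : ℕ} (hk : 1 ≤ k) {a u v b : List Bool} (huv : u.length = v.length)
    (hu : u.length ≤ k) (hd : d k (a ++ u ++ b) = d k (a ++ v ++ b)) : u = v := by
  refine List.ext_getElem huv fun e h1 h2 => ?_
  have hp := parity_eq_of_d_eq hd (Nat.mod_lt (a.length + e) (by omega))
  have hl : (a ++ u ++ b).length = (a ++ v ++ b).length := by simp [huv]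
  rw [← hl] at hp
  have hmem : a.length + e ∈ (Finset.range (a ++ u ++ b).length).filter
      (fun i => i % k = (a.length + e) % k) := by
    simp
    omega
  rw [← Finset.add_sum_erase _ _ hmem, ← Finset.add_sum_erase _ _ hmem] at hp
  have hrest : ∑ i ∈ ((Finset.range (a ++ u ++ b).length).filter
        (fun i => i % k = (a.length + e) % k)).erase (a.length + e),
        ((a ++ u ++ b).getD i false).toNat =
      ∑ i ∈ ((Finset.range (a ++ u ++ b).length).filter
        (fun i => i % k = (a.length + e) % k)).erase (a.length + e),
        ((a ++ v ++ b).getD i false).toNat := by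
    refine Finset.sum_congr rfl fun i hi => ?_
    rw [Finset.mem_erase, Finset.mem_filter] at hi
    rw [getD_window huv]
    by_contra hcon
    push Not at hcon
    apply hi.1
    have hmod : i ≡ a.length + e [MOD k] := hi.2.2
    rcases le_total i (a.length + e) with hle | hle
    · have := (Nat.modEq_iff_dvd' hle).1 hmod
      have := Nat.eq_zero_of_dvd_of_lt this (by omega)
      omega
    · have := (Nat.modEq_iff_dvd' hle).1 hmod.symm
      have := Nat.eq_zero_of_dvd_of_lt this (by omega)
      omega
  rw [hrest] at hp
  have e1 : (a ++ u ++ b).getD (a.length + e) false = u[e] := by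
    rw [List.append_assoc, List.getD_append_right _ _ _ _ (by omega)]
    rw [Nat.add_sub_cancel_left, List.getD_append _ _ _ _ h1, List.getD_eq_getElem _ _ h1]
  have e2 : (a ++ v ++ b).getD (a.length + e) false = v[e] := by
    rw [List.append_assoc, List.getD_append_right _ _ _ _ (by omega)]
    rw [Nat.add_sub_cancel_left, List.getD_append _ _ _ _ h2, List.getD_eq_getElem _ _ h2]
  rw [e1, e2] at hp
  cases hue : u[e] <;> cases hve : v[e] <;> simp [hue, hve] at hp ⊢ <;> omega

/-- If an edit keeps the lengths of all parts and the sum of the values `d` then it changes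
nothing. -/
lemma eq_of_sum_d_eq {k : ℕ} (hk : 1 ≤ k) : ∀ (M M' : List (List Bool)) (p u v q : List Bool),
    u.length = v.length → u.length ≤ k → M.map List.length = M'.map List.length →
    M.flatten = p ++ u ++ q → M'.flatten = p ++ v ++ q →
    (∀ m ∈ M.tail, pattern k <+: m) → (∀ m ∈ M'.tail, pattern k <+: m) →
    (M.map (d k)).sum = (M'.map (d k)).sum → u = v := by
  intro M
  induction M with
  | nil =>
    intro M' p u v q huv _ _ h1 _ _ _ _
    simp at h1
    have : v = [] := List.eq_nil_of_length_eq_zero (by rw [← huv, h1.2.1]; rfl)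
    rw [this, h1.2.1]
  | cons m M ih =>
    intro M' p u v q huv hu hl h1 h2 ht ht' hd
    cases M' with
    | nil => simp at hl
    | cons m' M' =>
      simp only [List.map_cons, List.cons.injEq, List.flatten_cons, List.tail_cons, List.sum_cons]
        at hl h1 h2 ht ht' hd
      -- Parts that end before the edit are stripped; what remains starts with the part in which the
      -- edit begins.
      by_cases c1 : m.length ≤ p.length
      · obtain ⟨p1, hp1⟩ : m <+: p := List.prefix_of_prefix_length_le
          ⟨M.flatten, by rw [h1]⟩ ⟨u ++ q, by simp⟩ c1
        obtain ⟨p2, hp2⟩ : m' <+: p := List.prefix_of_prefix_length_le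
          ⟨M'.flatten, by rw [h2]⟩ ⟨v ++ q, by simp⟩ (by omega)
        obtain ⟨rfl, rfl⟩ := List.append_inj (hp1.trans hp2.symm) hl.1
        rw [← hp1] at h1 h2
        simp only [List.append_assoc, List.append_cancel_left_eq] at h1 h2
        exact ih M' p1 u v q huv hu hl.2 (by simpa using h1) (by simpa using h2)
          (fun r hr => ht r (List.mem_of_mem_tail hr)) (fun r hr => ht' r (List.mem_of_mem_tail hr))
          (by omega)
      · obtain ⟨w, hw⟩ : p <+: m := List.prefix_of_prefix_length_le
          ⟨u ++ q, by rw [← List.append_assoc]⟩ ⟨M.flatten, by rw [h1]⟩ (by omega)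
        obtain ⟨w', hw'⟩ : p <+: m' := List.prefix_of_prefix_length_le
          ⟨v ++ q, by rw [← List.append_assoc]⟩ ⟨M'.flatten, by rw [h2]⟩ (by omega)
        subst hw hw'
        have hww : w.length = w'.length := by simpa using hl.1
        simp only [List.append_assoc, List.append_cancel_left_eq] at h1 h2
        have hF : M.flatten.length = M'.flatten.length := by
          simp only [List.length_flatten, hl.2]
        by_cases c2 : u.length ≤ w.length
        · obtain ⟨r, hr⟩ : u <+: w := List.prefix_of_prefix_length_le
            ⟨q, rfl⟩ ⟨M.flatten, by rw [h1]⟩ c2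
          obtain ⟨r', hr'⟩ : v <+: w' := List.prefix_of_prefix_length_le
            ⟨q, rfl⟩ ⟨M'.flatten, by rw [h2]⟩ (by omega)
          subst hr hr'
          simp only [List.append_assoc, List.append_cancel_left_eq] at h1 h2
          simp only [List.length_append] at hww
          obtain ⟨rfl, hFF⟩ := List.append_inj (h1.trans h2.symm) (by omega)
          have hM : M = M' := List.eq_iff_flatten_eq.2 ⟨hFF, hl.2⟩
          subst hM
          exact eq_of_d_eq hk (a := p) (b := r) huv hu (by simpa using hd)
        · obtain ⟨r, hr⟩ : w <+: u := List.prefix_of_prefix_length_le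
            ⟨M.flatten, by rw [h1]⟩ ⟨q, rfl⟩ (by omega)
          obtain ⟨r', hr'⟩ : w' <+: v := List.prefix_of_prefix_length_le
            ⟨M'.flatten, by rw [h2]⟩ ⟨q, rfl⟩ (by omega)
          subst hr hr'
          simp only [List.append_assoc, List.append_cancel_left_eq] at h1 h2
          simp only [List.length_append] at huv hu c2
          -- The edit reaches over the next cut. Its overhang has length at most `k` and starts the
          -- pattern, so it consists of zeros in both strings; only `w` and `w'` in the first part
          -- can differ.
          have hz : ∀ (M : List (List Bool)) (r : List Bool), M.flatten = r ++ q →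
              (∀ m ∈ M, pattern k <+: m) → r.length ≤ k → 0 < r.length →
              r = List.replicate r.length false := by
            intro M r hM hpm hr hr0
            cases M with
            | nil => simp at hM; simp [hM.1] at hr0
            | cons m M =>
              have hpre : pattern k <+: r ++ q := by
                rw [← hM, List.flatten_cons]
                exact (hpm m (by simp)).trans (List.prefix_append _ _)
              have hpre' := (pattern_prefix_iff hk (i := 0)).1 (by simpa using hpre)
              refine List.ext_getElem (by simp) fun e h1 h2 => ?_
              have := hpre'.1 e (by omega)
              rw [zero_add, List.getD_append _ _ _ _ h1, List.getD_eq_getElem _ _ h1] at this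
              simp [this]
          have e1 := hz M r h1 ht (by omega) (by omega)
          have e2 := hz M' r' h2 ht' (by omega) (by omega)
          have hrr : r = r' := by rw [e1, e2]; congr 1; omega
          subst hrr
          have hM : M = M' := List.eq_iff_flatten_eq.2 ⟨h1.trans h2.symm, hl.2⟩
          subst hM
          have := eq_of_d_eq hk (a := p) (b := []) (u := w) (v := w') hww (by omega)
            (by simpa using hd)
          rw [this]

/-! ### Counting `1^k` when occurrences of the pattern move -/

/-- The differences span at most `k` positions and meet both the occurrence lost at `i` and the one
gained at `j`, which confines them to `[i + k, j + k)`. So the zeros of the first and the ones of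
the second are unchanged, and the ones of the first are broken by a zero of `y` at some `g`. A new
`1^k` in `y` would lie between the zeros before `i + k` and those from `j` on, and would have to
contain `g`. Thus `y` gains no `1^k` and loses the one at `i + k`. -/
lemma numOnes_lt_of_pattern_moves {k : ℕ} (hk : 1 ≤ k) {x y : List Bool}
    (hl : x.length = y.length)
    (hd : ∀ e e', x.getD e false ≠ y.getD e false → x.getD e' false ≠ y.getD e' false → e < e' + k)
    {i j : ℕ} (hij : i < j) (hxi : pattern k <+: x.drop i) (hyi : ¬ pattern k <+: y.drop i)
    (hxj : ¬ pattern k <+: x.drop j) (hyj : pattern k <+: y.drop j) :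
    numOnes k y < numOnes k x := by
  rw [pattern_prefix_iff hk] at hxi hyi hxj hyj
  generalize hX : (fun i => x.getD i false) = X at *
  generalize hY : (fun i => y.getD i false) = Y at *
  have hX' : ∀ i, x.getD i false = X i := fun i => by rw [← hX]
  have hY' : ∀ i, y.getD i false = Y i := fun i => by rw [← hY]
  simp only [hX', hY'] at hd hxi hyi hxj hyj
  have hx0 : ∀ e, i ≤ e → e < i + k → X e = false := fun e h1 h2 => by
    have := hxi.1 (e - i) (by omega); rwa [show i + (e - i) = e by omega] at this
  have hx1 : ∀ e, i + k ≤ e → e < i + 2 * k → X e = true := fun e h1 h2 => by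
    have := hxi.2 (e - (i + k)) (by omega); rwa [show i + k + (e - (i + k)) = e by omega] at this
  have hy0 : ∀ e, j ≤ e → e < j + k → Y e = false := fun e h1 h2 => by
    have := hyj.1 (e - j) (by omega); rwa [show j + (e - j) = e by omega] at this
  have hy1 : ∀ e, j + k ≤ e → e < j + 2 * k → Y e = true := fun e h1 h2 => by
    have := hyj.2 (e - (j + k)) (by omega); rwa [show j + k + (e - (j + k)) = e by omega] at this
  obtain ⟨g, hg1, hg2, hg⟩ : ∃ g, i ≤ g ∧ g < i + 2 * k ∧ X g ≠ Y g := by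
    by_contra hcon
    push Not at hcon
    refine hyi ⟨fun e he => ?_, fun e he => ?_⟩
    · rw [← hcon _ (by omega) (by omega)]; exact hxi.1 e he
    · rw [← hcon _ (by omega) (by omega)]; exact hxi.2 e he
  obtain ⟨g', hg1', hg2', hg'⟩ : ∃ g, j ≤ g ∧ g < j + 2 * k ∧ X g ≠ Y g := by
    by_contra hcon
    push Not at hcon
    refine hxj ⟨fun e he => ?_, fun e he => ?_⟩
    · rw [hcon _ (by omega) (by omega)]; exact hyj.1 e he
    · rw [hcon _ (by omega) (by omega)]; exact hyj.2 e he
  -- Where the ones lost and the zeros gained overlap, every position is a difference; this settles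
  -- the cases of close `i` and `j` below.
  have hneq : ∀ e, i + k ≤ e → e < i + 2 * k → j ≤ e → e < j + k → X e ≠ Y e :=
    fun e h1 h2 h3 h4 => by rw [hx1 e h1 h2, hy0 e h3 h4]; simp
  have hlow : ∀ e, X e ≠ Y e → i + k ≤ e := by
    intro e he
    by_contra hlt
    have a1 := hd g' e hg' he
    have a2 := hd g e hg he
    by_cases c1 : j < i + k
    · have b1 := hd (j + k - 1) e (hneq _ (by omega) (by omega) (by omega) (by omega)) he
      exact he ((hx0 e (by omega) (by omega)).trans (hy0 e (by omega) (by omega)).symm)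
    · by_cases c2 : j < i + 2 * k
      · have := hd (i + 2 * k - 1) e (hneq _ (by omega) (by omega) (by omega) (by omega)) he
        omega
      · omega
  have hhigh : ∀ e, X e ≠ Y e → e < j + k := by
    intro e he
    by_contra hlt
    have a1 := hd e g he hg
    by_cases c1 : j < i + k
    · have b1 := hd e (i + k) he (hneq _ (by omega) (by omega) (by omega) (by omega))
      exact he ((hx1 e (by omega) (by omega)).trans (hy1 e (by omega) (by omega)).symm)
    · by_cases c2 : j < i + 2 * k
      · have := hd e j he (hneq _ (by omega) (by omega) (by omega) (by omega))
        omega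
      · omega
  have hYg : Y g = false := by
    have := hx1 g (hlow g hg) hg2
    rw [this] at hg
    simpa using hg
  have hgg' := hd g' g hg' hg
  have hg_low := hlow g hg
  have hg_high' := hhigh g' hg'
  unfold numOnes
  refine Finset.card_lt_card (Finset.ssubset_iff_of_subset ?_ |>.2 ⟨i + k, ?_, ?_⟩)
  · intro o ho
    simp only [Finset.mem_filter, Finset.mem_range, ones_prefix_iff, hX', hY'] at ho ⊢
    refine ⟨by omega, fun e he => ?_⟩
    have hones : ∀ e, o ≤ e → e < o + k → Y e = true := fun e h1 h2 => by
      have := ho.2 (e - o) (by omega); rwa [show o + (e - o) = e by omega] at this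
    by_contra hne
    have hdiff : X (o + e) ≠ Y (o + e) := by
      rw [hones _ (by omega) (by omega)]; exact hne
    have b1 := hlow _ hdiff
    have b2 := hhigh _ hdiff
    have c0 : i + k ≤ o := by
      by_contra hlt
      have h1 : Y (i + k - 1) = false := by
        have h3 : X (i + k - 1) = Y (i + k - 1) := by
          by_contra h4
          have := hlow _ h4
          omega
        rw [← h3]
        exact hx0 _ (by omega) (by omega)
      have h2 := hones (i + k - 1) (by omega) (by omega)
      rw [h1] at h2
      simp at h2
    have c1 : o + k ≤ j := by
      by_contra hlt
      have h1 := hy0 (max o j) (by omega) (by omega)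
      have h2 := hones (max o j) (by omega) (by omega)
      rw [h1] at h2
      simp at h2
    by_cases c2 : o ≤ g
    · by_cases c3 : g < o + k
      · have h2 := hones g (by omega) (by omega)
        rw [hYg] at h2
        simp at h2
      · omega
    · omega
  · simp only [Finset.mem_filter, Finset.mem_range, ones_prefix_iff, hX']
    refine ⟨?_, hxi.2⟩
    by_contra hlt
    have h1 := hX' (i + k)
    rw [List.getD_eq_default _ _ (by omega), hx1 _ (by omega) (by omega)] at h1
    simp at h1
  · simp only [Finset.mem_filter, Finset.mem_range, ones_prefix_iff, hY', not_and]
    intro _ hones'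
    have hones : ∀ e, i + k ≤ e → e < i + k + k → Y e = true := fun e h1 h2 => by
      have := hones' (e - (i + k)) (by omega); rwa [show i + k + (e - (i + k)) = e by omega] at this
    have h2 := hones g (by omega) (by omega)
    rw [hYg] at h2
    simp at h2

/-- A substitution that keeps the numbers of occurrences of the pattern and of `1^k` keeps the
positions of the pattern. -/
lemma pattern_positions_eq {k : ℕ} (hk : 1 ≤ k) {a u v b : List Bool} (huv : u.length = v.length)
    (hu : u.length ≤ k) (ho : occ (pattern k) (a ++ u ++ b) = occ (pattern k) (a ++ v ++ b))
    (hn : numOnes k (a ++ u ++ b) = numOnes k (a ++ v ++ b)) (i : ℕ) :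
    pattern k <+: (a ++ u ++ b).drop i ↔ pattern k <+: (a ++ v ++ b).drop i := by
  have hl : (a ++ u ++ b).length = (a ++ v ++ b).length := by simp [huv]
  have hw : ∀ e, (a ++ u ++ b).getD e false ≠ (a ++ v ++ b).getD e false →
      a.length ≤ e ∧ e < a.length + u.length := by
    intro e he
    by_contra hcon
    exact he (getD_window huv (by omega))
  have hd : ∀ e e', (a ++ u ++ b).getD e false ≠ (a ++ v ++ b).getD e false →
      (a ++ u ++ b).getD e' false ≠ (a ++ v ++ b).getD e' false → e < e' + k := by
    intro e e' h1 h2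
    have := hw e h1
    have := hw e' h2
    omega
  generalize a ++ u ++ b = x at *
  generalize a ++ v ++ b = y at *
  have hS : (Finset.range x.length).filter (fun i => pattern k <+: x.drop i) =
      (Finset.range y.length).filter (fun i => pattern k <+: y.drop i) := by
    -- The two sets of positions have equal size, so if they differ, each has an element missing
    -- from the other; whichever is further left, the number of `1^k` changes.
    by_contra hne
    obtain ⟨i, hi⟩ : ∃ i ∈ (Finset.range x.length).filter (fun i => pattern k <+: x.drop i),
        i ∉ (Finset.range y.length).filter (fun i => pattern k <+: y.drop i) := by
      by_contra hcon
      push Not at hcon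
      exact hne (Finset.eq_of_subset_of_card_le hcon (le_of_eq ho.symm))
    obtain ⟨j, hj⟩ : ∃ i ∈ (Finset.range y.length).filter (fun i => pattern k <+: y.drop i),
        i ∉ (Finset.range x.length).filter (fun i => pattern k <+: x.drop i) := by
      by_contra hcon
      push Not at hcon
      exact hne (Finset.eq_of_subset_of_card_le hcon (le_of_eq ho)).symm
    simp only [Finset.mem_filter, Finset.mem_range, not_and] at hi hj
    rcases lt_trichotomy i j with h1 | h1 | h1
    · have := numOnes_lt_of_pattern_moves hk hl hd h1 hi.1.2 (hi.2 (by omega)) (hj.2 (by omega))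
        hj.1.2
      omega
    · subst h1
      exact hi.2 (by omega) hj.1.2
    · have := numOnes_lt_of_pattern_moves hk hl.symm (fun e e' h1 h2 => hd e e' h1.symm h2.symm) h1
        hj.1.2 (hj.2 (by omega)) (hi.2 (by omega)) hi.1.2
      omega
  have hmem : ∀ (z : List Bool), pattern k <+: z.drop i → i < z.length := by
    intro z hz
    have := hz.length_le
    rw [pattern_length, List.length_drop] at this
    omega
  have := Finset.ext_iff.1 hS i
  simp only [Finset.mem_filter, Finset.mem_range] at this
  exact ⟨fun h1 => (this.1 ⟨hmem _ h1, h1⟩).2, fun h1 => (this.2 ⟨hmem _ h1, h1⟩).2⟩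

/-! ### Sums of `f` over the changed parts -/

lemma f_le (k : ℕ) (q : List Bool) : f k q ≤ 2 ^ k + (B k + C k) * q.length := by
  have h1 := (d_lt k q).le
  have h2 : numOnes k q ≤ q.length := occ_le_length _ _
  have h3 := Nat.mul_le_mul_left (B k) h2
  unfold f
  linarith [add_mul (B k) (C k) q.length]

lemma sum_f_eq (k : ℕ) (M : List (List Bool)) :
    (M.map (f k)).sum = (M.map (d k)).sum + B k * (M.map (numOnes k)).sum
      + C k * (M.map List.length).sum := by
  induction M with
  | nil => simp
  | cons m M ih => simp only [List.map_cons, List.sum_cons, ih, f]; ring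

lemma sum_d_lt {k : ℕ} {M : List (List Bool)} (hM : M.length ≤ 3) :
    (M.map (d k)).sum < 3 * 2 ^ k := by
  have h1 : (M.map (d k)).sum ≤ (M.map (d k)).length • (2 ^ k - 1) := by
    refine List.sum_le_card_nsmul _ _ fun a ha => ?_
    obtain ⟨q, _, rfl⟩ := List.mem_map.1 ha
    have := d_lt k q
    omega
  have h2 : M.length * (2 ^ k - 1) ≤ 3 * (2 ^ k - 1) := Nat.mul_le_mul_right _ hM
  have h3 := Nat.one_le_two_pow (n := k)
  simp only [List.length_map, smul_eq_mul] at h1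
  omega

/-- The `3k` allows `k` occurrences in `u` and `k` at each of its two ends. -/
lemma numOnes_window_bounds (k : ℕ) {p u q : List Bool} (hu : u.length ≤ k) :
    numOnes k p + numOnes k q ≤ numOnes k (p ++ u ++ q) ∧
      numOnes k (p ++ u ++ q) ≤ numOnes k p + numOnes k q + 3 * k := by
  simp only [numOnes_eq_occ, List.append_assoc]
  have h1 := le_occ_append (List.replicate k true) p (u ++ q)
  have h2 := le_occ_append (List.replicate k true) u q
  have h3 := occ_append_le (List.replicate k true) p (u ++ q)
  have h4 := occ_append_le (List.replicate k true) u q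
  have h5 := occ_le_length (List.replicate k true) u
  simp only [List.length_replicate] at h3 h4
  omega

/-- The sum can grow by less than `3·2^k` through `d`, at most `3kB = 9k2^k` through the count of
`1^k` and at most `kC` through the length; the first two together stay below `C`. -/
lemma sketch_sum_lt {k dM dM' nM nM' p u v q : ℕ} (hk : 1 ≤ k) (hb : 1 ≤ 2 ^ k)
    (hd : dM < 3 * 2 ^ k) (hn : nM ≤ nM' + 3 * k) (hu : u ≤ k) :
    dM + B k * nM + C k * (p + u + q) <
      dM' + B k * nM' + C k * (p + v + q) + 2 * k * C k := by
  simp only [B, C]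
  generalize 2 ^ k = b at *
  have e1 : 3 * b * nM ≤ 3 * b * (nM' + 3 * k) := Nat.mul_le_mul_left _ hn
  have e2 : 40 * k * b * (p + u + q) ≤ 40 * k * b * (p + v + q + k) :=
    Nat.mul_le_mul_left _ (by omega)
  have e3 : 1 * b ≤ k * b := Nat.mul_le_mul_right _ hk
  have e4 : 1 * (k * b) ≤ k * (k * b) := Nat.mul_le_mul_right _ hk
  linarith

/-- Mixed radix: `d` and the count of `1^k` cannot compensate one unit of `C`, and `d`, summed over
at most three parts, cannot compensate one unit of `B = 3·2^k`. -/
lemma sketch_sum_inj {k dM dM' nM nM' l l' : ℕ} (hk : 1 ≤ k) (hb : 1 ≤ 2 ^ k)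
    (hd : dM < 3 * 2 ^ k) (hd' : dM' < 3 * 2 ^ k) (hn : nM ≤ nM' + 3 * k) (hn' : nM' ≤ nM + 3 * k)
    (h : dM + B k * nM + C k * l = dM' + B k * nM' + C k * l') :
    l = l' ∧ nM = nM' ∧ dM = dM' := by
  simp only [B, C] at h
  generalize 2 ^ k = b at *
  have e1 : 3 * b * nM ≤ 3 * b * (nM' + 3 * k) := Nat.mul_le_mul_left _ hn
  have e2 : 3 * b * nM' ≤ 3 * b * (nM + 3 * k) := Nat.mul_le_mul_left _ hn'
  have e3 : 1 * b ≤ k * b := Nat.mul_le_mul_right _ hk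
  have hl : l = l' := by
    rcases lt_trichotomy l l' with hlt | heq | hlt
    · have e4 : 40 * k * b * (l + 1) ≤ 40 * k * b * l' := Nat.mul_le_mul_left _ hlt
      exfalso
      linarith
    · exact heq
    · have e4 : 40 * k * b * (l' + 1) ≤ 40 * k * b * l := Nat.mul_le_mul_left _ hlt
      exfalso
      linarith
  subst hl
  have hN : nM = nM' := by
    rcases lt_trichotomy nM nM' with hlt | heq | hlt
    · have e4 : 3 * b * (nM + 1) ≤ 3 * b * nM' := Nat.mul_le_mul_left _ hlt
      exfalso
      linarith
    · exact heq
    · have e4 : 3 * b * (nM' + 1) ≤ 3 * b * nM := Nat.mul_le_mul_left _ hlt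
      exfalso
      linarith
  subst hN
  exact ⟨rfl, rfl, by omega⟩

/-- The effect of an edit on the parts and on the values of `f`. -/
lemma exists_parts_of_edit {k : ℕ} (hk : 1 ≤ k) {x y : List Bool} (hxy : SubstringEdit k x y) :
    ∃ P M M' S, parts k x = P ++ M ++ S ∧ parts k y = P ++ M' ++ S ∧
      1 ≤ M.length ∧ 1 ≤ M'.length ∧ M.length ≤ 3 ∧ M'.length ≤ 3 ∧
      (M.map (f k)).sum < (M'.map (f k)).sum + 2 * k * C k ∧
      (M'.map (f k)).sum < (M.map (f k)).sum + 2 * k * C k ∧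
      (M.length = M'.length → (M.map (f k)).sum = (M'.map (f k)).sum → x = y) := by
  obtain ⟨a, u, v, b, hu, hv, rfl, rfl⟩ := hxy
  obtain ⟨P, p, q, S, hP⟩ := exists_parts_edit hk a b
  obtain ⟨m, M, h1, h2, h3⟩ := hP u hu
  obtain ⟨m', M', h1', h2', h3'⟩ := hP v hv
  have tail_pat : ∀ {z : List Bool} {m : List Bool} {M : List (List Bool)},
      parts k z = P ++ (m :: M) ++ S → ∀ r ∈ M, pattern k <+: r := by
    intro z m M hz r hr
    refine pattern_prefix_of_mem_tail hk z r ?_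
    rw [hz]
    cases P <;> simp [hr]
  have t1 := tail_pat h1
  have t1' := tail_pat h1'
  have n1 := numOnes_flatten hk M m t1
  have n1' := numOnes_flatten hk M' m' t1'
  have l1 : ((m :: M).map List.length).sum = p.length + u.length + q.length := by
    rw [← List.length_flatten, h2]; simp [add_assoc]
  have l1' : ((m' :: M').map List.length).sum = p.length + v.length + q.length := by
    rw [← List.length_flatten, h2']; simp [add_assoc]
  have s1 := sum_f_eq k (m :: M)
  have s1' := sum_f_eq k (m' :: M')
  have d1 := sum_d_lt (k := k) (M := m :: M) (by simp; omega)
  have d1' := sum_d_lt (k := k) (M := m' :: M') (by simp; omega)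
  have w1 := numOnes_window_bounds k (p := p) (q := q) hu
  have w1' := numOnes_window_bounds k (p := p) (q := q) hv
  rw [← n1, l1, h2] at s1
  rw [← n1', l1', h2'] at s1'
  have hb := Nat.one_le_two_pow (n := k)
  refine ⟨P, m :: M, m' :: M', S, h1, h1', by simp, by simp, by simp; omega, by simp; omega,
    ?_, ?_, ?_⟩
  · rw [s1, s1']
    exact sketch_sum_lt hk hb d1 (by omega) (by omega)
  · rw [s1, s1']
    exact sketch_sum_lt hk hb d1' (by omega) (by omega)
  · intro hlen hsum
    rw [s1, s1'] at hsum
    obtain ⟨hL, hN, hD⟩ := sketch_sum_inj hk hb d1 d1' (by omega) (by omega) hsum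
    replace hL : u.length = v.length := by omega
    have hocc : occ (pattern k) (a ++ u ++ b) = occ (pattern k) (a ++ v ++ b) := by
      have c1 := length_parts k (a ++ u ++ b)
      have c2 := length_parts k (a ++ v ++ b)
      rw [h1] at c1
      rw [h1'] at c2
      simp only [List.length_append, List.length_cons] at c1 c2 hlen
      omega
    have hnum : ∀ z, numOnes k z = ((parts k z).map (numOnes k)).sum := by
      intro z
      obtain ⟨r, rs, hr⟩ := List.exists_cons_of_ne_nil (parts_ne_nil k z)
      have := numOnes_flatten hk rs r
        (by have := pattern_prefix_of_mem_tail hk z; rwa [hr] at this)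
      rwa [← hr, flatten_parts] at this
    have hnumx : numOnes k (a ++ u ++ b) = numOnes k (a ++ v ++ b) := by
      rw [hnum (a ++ u ++ b), hnum (a ++ v ++ b), h1, h1']
      rw [h2, n1] at *
      rw [h2', n1'] at *
      simp only [List.map_append, List.sum_append, hN]
    -- Equal lengths and equal numbers of cuts and of `1^k`: no cut has moved, and the sum of `d`
    -- settles the rest.
    have hml := map_length_parts_eq (k := k) (x := a ++ u ++ b) (y := a ++ v ++ b) (by simp [hL])
      (pattern_positions_eq hk hL hu hocc hnumx)
    rw [h1, h1'] at hml
    simp only [List.map_append, List.append_assoc, List.append_cancel_left_eq] at hml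
    have hml' := (List.append_inj hml (by simpa using hlen)).1
    rw [eq_of_sum_d_eq hk _ _ p u v q hL hu hml' h2 h2' (by simpa using t1) (by simpa using t1') hD]

/-! ### The VT sketch -/

lemma sum_range_getD (l : List ℕ) : ∑ i ∈ Finset.range l.length, l.getD i 0 = l.sum := by
  induction l with
  | nil => simp
  | cons c l ih =>
    rw [List.length_cons, Finset.sum_range_succ', List.sum_cons, ← ih]
    simp [add_comm]

lemma VT_cons (c : ℕ) (l : List ℕ) : VT (c :: l) = c + VT l + l.sum := by
  rw [VT, VT, List.length_cons, Finset.sum_range_succ', ← sum_range_getD l]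
  simp only [List.getD_cons_succ, List.getD_cons_zero]
  rw [add_assoc, ← Finset.sum_add_distrib, add_comm]
  congr 1
  · ring
  · exact Finset.sum_congr rfl fun i _ => by ring

lemma VT_append (l l' : List ℕ) : VT (l ++ l') = VT l + VT l' + l.length * l'.sum := by
  induction l with
  | nil => simp [VT]
  | cons c l ih =>
    rw [List.cons_append, VT_cons, VT_cons, ih]
    simp only [List.sum_append, List.length_cons]
    ring

lemma VT_le (l : List ℕ) : VT l ≤ l.length * l.sum := by
  induction l with
  | nil => simp [VT]
  | cons c l ih =>
    rw [VT_cons]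
    simp only [List.length_cons, List.sum_cons]
    nlinarith [Nat.zero_le (l.length * c)]

/-- If two integer strings of the same length and sum differ by local changes on both sides of
a common segment `R`, and their sketches agree, then `R` is short. -/
lemma length_le_of_VT_modEq {P M M' R N N' S : List ℕ} {D Q : ℕ}
    (hM1 : 1 ≤ M.length) (hM1' : 1 ≤ M'.length)
    (hM : M.length ≤ 3) (hM' : M'.length ≤ 3) (hN : N.length ≤ 3) (hN' : N'.length ≤ 3)
    (hlen : M.length + N'.length = M'.length + N.length) (hsum : M.sum + N'.sum = M'.sum + N.sum)
    (hD : M.sum < M'.sum + D) (hD' : M'.sum < M.sum + D)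
    (hne : M.length = M'.length → M.sum ≠ M'.sum) (hR : ∀ r ∈ R, D ≤ r)
    (hQ : 20 * (P ++ M ++ R ++ N' ++ S).sum < Q)
    (hVT : VT (P ++ M ++ R ++ N' ++ S) ≡ VT (P ++ M' ++ R ++ N ++ S) [MOD Q]) :
    R.length ≤ 6 * (M.sum + N'.sum) := by
  have hRD : R.length * D ≤ R.sum := by
    simpa using List.card_nsmul_le_sum R D hR
  have vM := (VT_le M).trans (Nat.mul_le_mul_right _ hM)
  have vM' := (VT_le M').trans (Nat.mul_le_mul_right _ hM')
  have vN := (VT_le N).trans (Nat.mul_le_mul_right _ hN)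
  have vN' := (VT_le N').trans (Nat.mul_le_mul_right _ hN')
  have m1 : M.length * N'.sum ≤ 3 * N'.sum := Nat.mul_le_mul_right _ hM
  have m2 : M'.length * N.sum ≤ 3 * N.sum := Nat.mul_le_mul_right _ hM'
  have hdvd := (Nat.modEq_iff_dvd.1 hVT.symm)
  simp only [VT_append, List.sum_append, List.length_append] at hdvd hQ
  clear hR hVT
  generalize M.sum = sM at *
  generalize M'.sum = sM' at *
  generalize N.sum = sN at *
  generalize N'.sum = sN' at *
  generalize R.sum = sR at *
  generalize P.sum = sP at *
  generalize S.sum = sS at *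
  push_cast at hdvd
  zify at *
  -- `E` is the part of the difference that does not involve `R`. Besides it, `R` is shifted by `|M|
  -- - |M'|` places, and the change of sum behind it, `sN' - sN = -(sM - sM')`, gets the weight
  -- `|R|`.
  set E : ℤ := VT M - VT M' + VT N' - VT N + M.length * sN' - M'.length * sN with hE
  have hdiff : (VT P + VT M + P.length * sM + VT R + (P.length + M.length) * sR + VT N' +
      (P.length + M.length + R.length) * sN' + VT S +
      (P.length + M.length + R.length + N'.length) * sS : ℤ) -
      (VT P + VT M' + P.length * sM' + VT R + (P.length + M'.length) * sR + VT N +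
      (P.length + M'.length + R.length) * sN + VT S +
      (P.length + M'.length + R.length + N.length) * sS) =
      E + (M.length - M'.length) * sR - R.length * (sM - sM') := by
    have e1 : (sN' : ℤ) = sM' + sN - sM := by linarith
    have e2 : (N'.length : ℤ) = M'.length + N.length - M.length := by linarith
    rw [hE, e1, e2]
    ring
  rw [hdiff] at hdvd
  have hR0 : (0 : ℤ) ≤ R.length := by positivity
  have b1 : (R.length : ℤ) * (sM - sM') ≤ R.length * (D - 1) :=
    mul_le_mul_of_nonneg_left (by linarith) hR0
  have b2 : (R.length : ℤ) * (sM' - sM) ≤ R.length * (D - 1) :=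
    mul_le_mul_of_nonneg_left (by linarith) hR0
  have p1 : (0 : ℤ) ≤ sP := by positivity
  have p2 : (0 : ℤ) ≤ sS := by positivity
  have p3 : (0 : ℤ) ≤ sM := by positivity
  have p4 : (0 : ℤ) ≤ sN' := by positivity
  have p5 : (0 : ℤ) ≤ sR := by positivity
  have p6 : (0 : ℤ) ≤ sM' := by positivity
  have p7 : (0 : ℤ) ≤ sN := by positivity
  have q1 : (0 : ℤ) ≤ VT M := by positivity
  have q2 : (0 : ℤ) ≤ VT M' := by positivity
  have q3 : (0 : ℤ) ≤ VT N := by positivity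
  have q4 : (0 : ℤ) ≤ VT N' := by positivity
  have q5 : (0 : ℤ) ≤ M.length * sN' := by positivity
  have q6 : (0 : ℤ) ≤ M'.length * sN := by positivity
  have E1 : E ≤ 6 * (sM + sN') := by linarith
  have E2 : -(6 * (sM + sN' : ℤ)) ≤ E := by linarith
  obtain ⟨t, ht⟩ : ∃ t : ℤ, t = M.length - M'.length := ⟨_, rfl⟩
  rw [← ht] at hdvd
  have t1 : -2 ≤ t := by linarith
  have t2 : t ≤ 2 := by linarith
  -- Every term is bounded by a small multiple of the total sum, so the difference is below the
  -- modulus.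
  have hzero : E + t * sR - R.length * (sM - sM') = 0 := by
    refine Int.eq_zero_of_abs_lt_dvd hdvd ?_
    have c1 : t * sR ≤ 2 * sR := mul_le_mul_of_nonneg_right t2 p5
    have c2 : -2 * sR ≤ t * sR := mul_le_mul_of_nonneg_right t1 p5
    rw [abs_lt]
    constructor <;> linarith
  -- For `t = 0` the sums differ, so `|R| ≤ |R| |sM - sM'| = |E|`. Otherwise `|t| sR ≥ |R| D`, which
  -- exceeds `|R| |sM - sM'|` by at least `|R|`.
  by_cases h0 : t = 0
  · have hne' := hne (by linarith)
    rw [h0] at hzero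
    rcases lt_or_gt_of_ne hne' with hlt | hlt
    · have : (R.length : ℤ) * 1 ≤ R.length * (sM' - sM) :=
        mul_le_mul_of_nonneg_left (by linarith) hR0
      linarith
    · have : (R.length : ℤ) * 1 ≤ R.length * (sM - sM') :=
        mul_le_mul_of_nonneg_left (by linarith) hR0
      linarith
  · rcases lt_or_gt_of_ne h0 with hlt | hlt
    · have : t * sR ≤ -1 * sR := mul_le_mul_of_nonneg_right (by linarith) p5
      linarith
    · have : 1 * (sR : ℤ) ≤ t * sR := mul_le_mul_of_nonneg_right (by linarith) p5
      linarith

/-! ### Confining the difference of two codewords -/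

lemma two_mul_C_le_f {k : ℕ} {q : List Bool} (hq : pattern k <+: q) : 2 * k * C k ≤ f k q := by
  have h1 := hq.length_le
  rw [pattern_length] at h1
  have h2 := Nat.mul_le_mul_left (C k) h1
  unfold f
  linarith [Nat.zero_le (d k q), Nat.zero_le (B k * numOnes k q)]

lemma sum_f_parts_le {k : ℕ} (x : List Bool) :
    ((parts k x).map (f k)).sum ≤ (x.length + 1) * 2 ^ k + (B k + C k) * x.length := by
  have h1 : ∀ M : List (List Bool), (M.map (f k)).sum ≤
      M.length * 2 ^ k + (B k + C k) * (M.map List.length).sum := by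
    intro M
    induction M with
    | nil => simp
    | cons m M ih =>
      have := f_le k m
      simp only [List.map_cons, List.sum_cons, List.length_cons]
      linarith
  have h2 := h1 (parts k x)
  rw [← List.length_flatten, flatten_parts, length_parts] at h2
  have h3 : (1 + occ (pattern k) x) * 2 ^ k ≤ (x.length + 1) * 2 ^ k :=
    Nat.mul_le_mul_right _ (by have := occ_le_length (pattern k) x; omega)
  linarith

/-- This is why the VT sketch may be taken modulo `2000Cn`: congruence becomes equality. -/
lemma sum_f_parts_small {k : ℕ} (hk : 1 ≤ k) {x : List Bool} (hx : 1 ≤ x.length) :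
    20 * ((parts k x).map (f k)).sum < 2000 * C k * x.length := by
  have h1 := sum_f_parts_le (k := k) x
  have hb := Nat.one_le_two_pow (n := k)
  simp only [B, C] at *
  generalize 2 ^ k = b at *
  generalize x.length = n at *
  have e1 : 1 * b ≤ n * b := Nat.mul_le_mul_right _ hx
  have e2 : 1 * (n * b) ≤ k * (n * b) := Nat.mul_le_mul_right _ hk
  have e3 : 0 < n * b := by positivity
  linarith

/-- The block of parts in which two strings with a common descendant and equal sketches differ. -/
lemma exists_common_parts_aux {k n : ℕ} (hk : 1 ≤ k) {x x' : List Bool}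
    (hx : x.length = n) (hxn : 1 ≤ n) (hh : h k n x = h k n x') (hxx : x ≠ x')
    {P M M' S P' N N' S' : List (List Bool)} {y : List Bool}
    (h1 : parts k x = P ++ M ++ S) (h2 : parts k y = P ++ M' ++ S)
    (h1' : parts k x' = P' ++ N ++ S') (h2' : parts k y = P' ++ N' ++ S')
    (hM1 : 1 ≤ M.length) (hM1' : 1 ≤ M'.length) (hN1 : 1 ≤ N.length) (hN1' : 1 ≤ N'.length)
    (hM : M.length ≤ 3) (hM' : M'.length ≤ 3) (hN : N.length ≤ 3) (hN' : N'.length ≤ 3)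
    (b1 : (M.map (f k)).sum < (M'.map (f k)).sum + 2 * k * C k)
    (b2 : (M'.map (f k)).sum < (M.map (f k)).sum + 2 * k * C k)
    (b1' : (N.map (f k)).sum < (N'.map (f k)).sum + 2 * k * C k)
    (b2' : (N'.map (f k)).sum < (N.map (f k)).sum + 2 * k * C k)
    (c1 : M.length = M'.length → (M.map (f k)).sum = (M'.map (f k)).sum → x = y)
    (c2 : N.length = N'.length → (N.map (f k)).sum = (N'.map (f k)).sum → x' = y)
    (hPP : P.length ≤ P'.length) :
    ∃ P G G' Z, parts k x = P ++ G ++ Z ∧ parts k x' = P ++ G' ++ Z ∧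
      (G.length ≤ 9 ∨ ∃ E : List (List Bool), (∀ r ∈ E, r ∈ G) ∧ E.length ≤ 6 ∧
        G.length ≤ 6 + 6 * (E.map (f k)).sum) := by
  have hpre : P <+: P' := List.prefix_of_prefix_length_le (l₃ := parts k y)
    ⟨M' ++ S, by rw [h2, List.append_assoc]⟩ ⟨N' ++ S', by rw [h2', List.append_assoc]⟩ hPP
  obtain ⟨H, rfl⟩ := hpre
  have hMS : M' ++ S = H ++ (N' ++ S') := by
    have := h2.symm.trans h2'
    simpa [List.append_assoc] using this
  -- Are the two changed runs disjoint in `y`? If so, `R` is the list of parts between them.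
  by_cases hlen : M'.length ≤ H.length
  · obtain ⟨R, rfl⟩ : M' <+: H := List.prefix_of_prefix_length_le ⟨S, rfl⟩
      ⟨N' ++ S', by rw [hMS]⟩ hlen
    simp only [List.append_assoc, List.append_cancel_left_eq] at hMS
    subst hMS
    have hRpat : ∀ r ∈ R, pattern k <+: r := by
      intro r hr
      refine pattern_prefix_of_mem_tail hk y r ?_
      rw [h2]
      obtain ⟨c, M'', rfl⟩ := List.exists_cons_of_length_pos (l := M') (by omega)
      cases P <;> simp [hr]
    simp only [h, Prod.mk.injEq, fString] at hh
    obtain ⟨hh1, hh2, hh3⟩ := hh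
    rw [h1, h1'] at hh1 hh2 hh3
    -- All four lengths lie between 1 and 3, so the two sides differ by at most 4, and the residue
    -- modulo 5 decides. Likewise the sums below differ by less than `2D`, against the modulus `5D`.
    have hL : M.length + N'.length = M'.length + N.length := by
      simp only [List.length_append] at hh3
      omega
    have hS : (M.map (f k)).sum + (N'.map (f k)).sum = (M'.map (f k)).sum + (N.map (f k)).sum := by
      simp only [List.map_append, List.sum_append] at hh2
      have hkc : 10 * C k * k = 5 * (2 * k * C k) := by ring
      rw [hkc] at hh2
      generalize 2 * k * C k = D at *
      rcases lt_trichotomy ((M.map (f k)).sum + (N'.map (f k)).sum)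
        ((M'.map (f k)).sum + (N.map (f k)).sum) with hlt | heq | hlt
      · have hdv := (Nat.modEq_iff_dvd' (by omega)).1 (show Nat.ModEq _ _ _ from hh2)
        have := Nat.eq_zero_of_dvd_of_lt hdv (by omega)
        omega
      · exact heq
      · have hdv := (Nat.modEq_iff_dvd' (by omega)).1 (show Nat.ModEq _ _ _ from hh2.symm)
        have := Nat.eq_zero_of_dvd_of_lt hdv (by omega)
        omega
    have hlenR := length_le_of_VT_modEq (P := P.map (f k)) (M := M.map (f k)) (M' := M'.map (f k))
      (R := R.map (f k)) (N := N.map (f k)) (N' := N'.map (f k)) (S := S'.map (f k))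
      (D := 2 * k * C k) (Q := 2000 * C k * n)
      (by simpa using hM1) (by simpa using hM1') (by simpa using hM) (by simpa using hM')
      (by simpa using hN) (by simpa using hN') (by simpa using hL) hS b1 b2
      -- If the first edit changes neither count nor sum, the second does not either, and `x = y =
      -- x'`.
      (fun e1 e2 => hxx <| by
        simp only [List.length_map] at e1
        rw [c1 e1 e2, c2 (by omega) (by omega)])
      (by
        intro r hr
        obtain ⟨q, hq, rfl⟩ := List.mem_map.1 hr
        exact two_mul_C_le_f (hRpat q hq))
      (by
        have := sum_f_parts_small hk (x := x) (by omega)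
        rw [h1, hx] at this
        simpa using this)
      (by simpa [Nat.ModEq] using hh1)
    refine ⟨P, M ++ R ++ N', M' ++ R ++ N, S', by simp [h1], by simp [h1'], Or.inr ?_⟩
    refine ⟨M ++ N', ?_, ?_, ?_⟩
    · intro r hr
      simp only [List.mem_append] at hr ⊢
      tauto
    · simp only [List.length_append]
      omega
    · simp only [List.map_append, List.sum_append, List.length_append, List.length_map] at hlenR ⊢
      omega
  -- The changed runs overlap in `y`, so only boundedly many parts are involved and no sketch is
  -- needed.
  · obtain ⟨W, rfl⟩ : H <+: M' := List.prefix_of_prefix_length_le (l₃ := M' ++ S)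
      ⟨N' ++ S', by rw [hMS]⟩ ⟨S, rfl⟩ (by omega)
    simp only [List.append_assoc, List.append_cancel_left_eq] at hMS
    simp only [List.length_append] at hM' hlen
    rcases List.append_eq_append_iff.1 hMS with ⟨T, hT1, hT2⟩ | ⟨T, hT1, hT2⟩
    · refine ⟨P, M ++ T, H ++ N, S', by simp [h1, hT2], by simp [h1'], Or.inl ?_⟩
      have := congrArg List.length hT1
      simp only [List.length_append] at this ⊢
      omega
    · refine ⟨P, M, H ++ N ++ T, S, by simp [h1], by simp [h1', hT2], Or.inl (by omega)⟩

/-- The string whose changed run starts further left is taken as `x₁`. Bounding `G` suffices: equal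
total lengths make `G'` equally long once flattened. -/
lemma exists_common_parts {k n : ℕ} (hk : 1 ≤ k) {x x' y : List Bool}
    (hx : x.length = n) (hx' : x'.length = n) (hn : 1 ≤ n) (hh : h k n x = h k n x')
    (hxx : x ≠ x') (hxy : SubstringEdit k x y) (hxy' : SubstringEdit k x' y) :
    ∃ x₁ x₂, (x₁ = x ∧ x₂ = x' ∨ x₁ = x' ∧ x₂ = x) ∧ ∃ P G G' Z,
      parts k x₁ = P ++ G ++ Z ∧ parts k x₂ = P ++ G' ++ Z ∧
      (G.length ≤ 9 ∨ ∃ E : List (List Bool), (∀ r ∈ E, r ∈ G) ∧ E.length ≤ 6 ∧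
        G.length ≤ 6 + 6 * (E.map (f k)).sum) := by
  obtain ⟨P, M, M', S, h1, h2, a1, a2, a3, a4, a5, a6, a7⟩ := exists_parts_of_edit hk hxy
  obtain ⟨P', N, N', S', h1', h2', d1, d2, d3, d4, d5, d6, d7⟩ := exists_parts_of_edit hk hxy'
  rcases le_total P.length P'.length with hle | hle
  · exact ⟨x, x', Or.inl ⟨rfl, rfl⟩, exists_common_parts_aux hk hx hn hh hxx h1 h2 h1' h2'
      a1 a2 d1 d2 a3 a4 d3 d4 a5 a6 d5 d6 a7 d7 hle⟩
  · exact ⟨x', x, Or.inr ⟨rfl, rfl⟩, exists_common_parts_aux hk hx' hn hh.symm hxx.symm h1' h2' h1 h2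
      d1 d2 a1 a2 d3 d4 a3 a4 d5 d6 a5 a6 d7 a7 hle⟩

/-- The constant in the bound on the length of the window in which two codewords differ. -/
noncomputable def windowConst (k : ℕ) : ℝ := 9 + 36 * (2 ^ k + B k + C k)

lemma windowConst_pos (k : ℕ) : 0 < windowConst k := by
  unfold windowConst
  positivity

lemma length_flatten_le {δ : ℝ} (G : List (List Bool)) (hG : ∀ q ∈ G, (q.length : ℝ) ≤ δ) :
    (G.flatten.length : ℝ) ≤ G.length * δ := by
  induction G with
  | nil => simp
  | cons g G ih =>
    have h1 := ih fun q hq => hG q (by simp [hq])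
    have h2 := hG g (by simp)
    simp only [List.flatten_cons, List.length_append, List.length_cons]
    push_cast
    linarith

/-- Two dense strings with equal sketches and a common descendant differ only in a short window. -/
theorem exists_window {k n : ℕ} {δ : ℝ} (hk : 1 ≤ k) {x x' y : List Bool}
    (hx : x.length = n) (hx' : x'.length = n) (hd : Dense k δ x) (hd' : Dense k δ x')
    (hh : h k n x = h k n x') (hxx : x ≠ x')
    (hxy : SubstringEdit k x y) (hxy' : SubstringEdit k x' y) :
    1 ≤ δ ∧ ∃ a w w' b, x = a ++ w ++ b ∧ x' = a ++ w' ++ b ∧ w.length = w'.length ∧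
      (w.length : ℝ) ≤ windowConst k * δ ^ 2 := by
  have hn : 1 ≤ n := by
    by_contra hlt
    apply hxx
    rw [List.eq_nil_of_length_eq_zero (l := x) (by omega),
      List.eq_nil_of_length_eq_zero (l := x') (by omega)]
  have hδ : 1 ≤ δ := by
    by_contra hlt
    push Not at hlt
    have hz : (parts k x).flatten.length = 0 := by
      rw [List.length_flatten, List.sum_eq_zero_iff]
      intro l hl
      obtain ⟨q, hq, rfl⟩ := List.mem_map.1 hl
      have := (hd q hq).trans_lt hlt
      have : q.length < 1 := by exact_mod_cast this
      omega
    rw [flatten_parts] at hz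
    omega
  refine ⟨hδ, ?_⟩
  obtain ⟨x₁, x₂, h12, P, G, G', Z, h1, h2, hG⟩ := exists_common_parts hk hx hx' hn hh hxx hxy hxy'
  have hl12 : x₁.length = x₂.length := by rcases h12 with ⟨rfl, rfl⟩ | ⟨rfl, rfl⟩ <;> omega
  have hd1 : Dense k δ x₁ := by rcases h12 with ⟨rfl, rfl⟩ | ⟨rfl, rfl⟩ <;> assumption
  have e1 : x₁ = P.flatten ++ G.flatten ++ Z.flatten := by
    rw [← flatten_parts k x₁, h1]; simp
  have e2 : x₂ = P.flatten ++ G'.flatten ++ Z.flatten := by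
    rw [← flatten_parts k x₂, h2]; simp
  have hlen : G.flatten.length = G'.flatten.length := by
    rw [e1, e2] at hl12
    simp only [List.length_append] at hl12
    omega
  have hGd : ∀ q ∈ G, (q.length : ℝ) ≤ δ := fun q hq => hd1 q (by rw [h1]; simp [hq])
  -- Each of the at most six parts in `E` has `f ≤ (2^k + B + C) δ`, as `δ ≥ 1`; the factor 6 from
  -- the sketch bound turns this into the 36 of `windowConst`.
  have hGlen : (G.length : ℝ) ≤ windowConst k * δ := by
    have hpos : (0 : ℝ) ≤ 36 * (2 ^ k + B k + C k) := by positivity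
    rcases hG with hG | ⟨E, hE1, hE2, hE3⟩
    · have : (G.length : ℝ) ≤ 9 := by exact_mod_cast hG
      unfold windowConst
      nlinarith
    · have hEs : ((E.map (f k)).sum : ℝ) ≤ E.length * ((2 ^ k + B k + C k) * δ) := by
        clear hE2 hE3
        induction E with
        | nil => simp
        | cons e E ih =>
          have i1 := ih fun r hr => hE1 r (by simp [hr])
          have i2 := hGd e (hE1 e (by simp))
          have i3 : (f k e : ℝ) ≤ 2 ^ k + (B k + C k) * e.length := by exact_mod_cast f_le k e
          have i4 : ((B k : ℝ) + C k) * e.length ≤ (B k + C k) * δ :=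
            mul_le_mul_of_nonneg_left i2 (by positivity)
          have i5 : (2 : ℝ) ^ k * 1 ≤ 2 ^ k * δ := mul_le_mul_of_nonneg_left hδ (by positivity)
          simp only [List.map_cons, List.sum_cons, List.length_cons]
          rw [Nat.cast_add, Nat.cast_add, Nat.cast_one]
          linarith
      have j1 : (E.length : ℝ) ≤ 6 := by exact_mod_cast hE2
      have j2 : (E.length : ℝ) * ((2 ^ k + B k + C k) * δ) ≤ 6 * ((2 ^ k + B k + C k) * δ) :=
        mul_le_mul_of_nonneg_right j1 (by positivity)
      have j3 : (G.length : ℝ) ≤ 6 + 6 * ((E.map (f k)).sum : ℕ) := by exact_mod_cast hE3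
      unfold windowConst
      linarith
  have hw : (G.flatten.length : ℝ) ≤ windowConst k * δ ^ 2 := by
    have := length_flatten_le G hGd
    have := mul_le_mul_of_nonneg_right hGlen (by linarith : (0 : ℝ) ≤ δ)
    linarith
  rcases h12 with ⟨rfl, rfl⟩ | ⟨rfl, rfl⟩
  · exact ⟨P.flatten, G.flatten, G'.flatten, Z.flatten, e1, e2, hlen, hw⟩
  · exact ⟨P.flatten, G'.flatten, G.flatten, Z.flatten, e2, e1, hlen.symm, by rw [← hlen]; exact hw⟩

/-! ### Common descendants of substrings -/

lemma SubstringEdit.append {k : ℕ} {x y : List Bool} (hxy : SubstringEdit k x y) (z : List Bool) :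
    SubstringEdit k (x ++ z) (y ++ z) := by
  obtain ⟨a, u, v, b, hu, hv, rfl, rfl⟩ := hxy
  exact ⟨a, u, v, b ++ z, hu, hv, by simp, by simp⟩

lemma SubstringEdit.reverse {k : ℕ} {x y : List Bool} (hxy : SubstringEdit k x y) :
    SubstringEdit k x.reverse y.reverse := by
  obtain ⟨a, u, v, b, hu, hv, rfl, rfl⟩ := hxy
  exact ⟨b.reverse, u.reverse, v.reverse, a.reverse, by simpa, by simpa, by simp, by simp⟩

/-- The delicate case is an edit at the very start with exactly one of `u`, `v` empty. The nonempty
one loses its first bit and absorbs the next bit of `b`, so its length stays at most `k`. -/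
lemma SubstringEdit.tail {k : ℕ} {x y : List Bool} (hxy : SubstringEdit k x y) :
    SubstringEdit k x.tail y.tail := by
  obtain ⟨a, u, v, b, hu, hv, rfl, rfl⟩ := hxy
  cases a with
  | cons c a => exact ⟨a, u, v, b, hu, hv, by simp, by simp⟩
  | nil =>
    cases u with
    | cons c u =>
      cases v with
      | cons d v =>
        exact ⟨[], u, v, b, by simp at hu; omega, by simp at hv; omega, by simp, by simp⟩
      | nil =>
        cases b with
        | nil => exact ⟨[], u, [], [], by simp at hu; omega, by simp, by simp, by simp⟩
        | cons e b => exact ⟨[], u ++ [e], [], b, by simpa using hu, by simp, by simp, by simp⟩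
    | nil =>
      cases b with
      | nil =>
        cases v with
        | nil => exact ⟨[], [], [], [], by simp, by simp, by simp, by simp⟩
        | cons d v => exact ⟨[], [], v, [], by simp, by simp at hv; omega, by simp, by simp⟩
      | cons e b =>
        cases v with
        | nil => exact ⟨[], [], [], b, by simp, by simp, by simp, by simp⟩
        | cons d v => exact ⟨[], [], v ++ [e], b, by simp, by simpa using hv, by simp, by simp⟩

lemma SubstringEdit.drop {k : ℕ} {x y : List Bool} (hxy : SubstringEdit k x y) (i : ℕ) :
    SubstringEdit k (x.drop i) (y.drop i) := by
  induction i with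
  | zero => simpa using hxy
  | succ i ih => simpa using ih.tail

/-- Two strings of the same length with a common descendant. -/
def Confusable (k : ℕ) (x x' : List Bool) : Prop :=
  x.length = x'.length ∧ ∃ y, SubstringEdit k x y ∧ SubstringEdit k x' y

lemma Confusable.drop {k : ℕ} {x x' : List Bool} (hx : Confusable k x x') (i : ℕ) :
    Confusable k (x.drop i) (x'.drop i) := by
  obtain ⟨hl, y, h1, h2⟩ := hx
  exact ⟨by simp [hl], _, h1.drop i, h2.drop i⟩

lemma Confusable.reverse {k : ℕ} {x x' : List Bool} (hx : Confusable k x x') :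
    Confusable k x.reverse x'.reverse := by
  obtain ⟨hl, y, h1, h2⟩ := hx
  exact ⟨by simp [hl], _, h1.reverse, h2.reverse⟩

lemma Confusable.append {k : ℕ} {x x' : List Bool} (hx : Confusable k x x') (z : List Bool) :
    Confusable k (x ++ z) (x' ++ z) := by
  obtain ⟨hl, y, h1, h2⟩ := hx
  exact ⟨by simp [hl], _, h1.append z, h2.append z⟩

lemma Confusable.take {k : ℕ} {x x' : List Bool} (hx : Confusable k x x') (i : ℕ) :
    Confusable k (x.take i) (x'.take i) := by
  have h1 := (hx.reverse.drop (x.length - i)).reverse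
  have e : ∀ z : List Bool, z.length = x.length →
      (z.reverse.drop (x.length - i)).reverse = z.take i := by
    intro z hz
    rw [List.reverse_drop, List.reverse_reverse, List.length_reverse, hz]
    rcases le_total i x.length with hi | hi
    · rw [Nat.sub_sub_self hi]
    · rw [List.take_of_length_le (by omega), List.take_of_length_le (by omega)]
  rwa [e x rfl, e x' hx.1.symm] at h1

/-! ### Blocks -/

lemma block_eq (A : ℕ) (x : List Bool) (i : ℕ) :
    block A x i = (x.drop (i * A)).take A ++
      List.replicate (A - ((x.drop (i * A)).take A).length) false := by
  rw [block, List.rightpad]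

lemma length_block (A : ℕ) (x : List Bool) (i : ℕ) : (block A x i).length = A := by
  rw [block_eq]
  simp

/-- Truncation at either end and equal padding keep a common descendant, so the block hash applies
to every pair of corresponding blocks. -/
lemma Confusable.block {k : ℕ} {x x' : List Bool} (hx : Confusable k x x') (A i : ℕ) :
    Confusable k (block A x i) (block A x' i) := by
  have h1 := (hx.drop (i * A)).take A
  rw [block_eq, block_eq, ← h1.1]
  exact h1.append _

lemma getD_block {A : ℕ} (x : List Bool) (i : ℕ) {j : ℕ} (hj : j < A) :
    (block A x i).getD j false = x.getD (i * A + j) false := by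
  rw [block_eq]
  by_cases h1 : j < ((x.drop (i * A)).take A).length
  · rw [List.getD_append _ _ _ _ h1]
    simp [List.getD, hj]
  · rw [List.getD_append_right _ _ _ _ (by omega)]
    simp only [List.length_take, List.length_drop] at h1
    rw [List.getD_eq_default x _ (by omega)]
    simp [List.getD, List.getElem?_replicate]
    split_ifs <;> simp

lemma eq_of_getD_eq {x x' : List Bool} (hl : x.length = x'.length)
    (hx : ∀ e < x.length, x.getD e false = x'.getD e false) : x = x' := by
  refine List.ext_getElem hl fun e h1 h2 => ?_
  have := hx e h1
  rwa [List.getD_eq_getElem _ _ h1, List.getD_eq_getElem _ _ h2] at this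

lemma eq_of_blocks_eq {A : ℕ} (hA : 1 ≤ A) {x x' : List Bool} (hl : x.length = x'.length)
    (hb : ∀ i < numBlocks A x, block A x i = block A x' i) : x = x' := by
  refine eq_of_getD_eq hl fun e he => ?_
  have h1 : e / A < numBlocks A x := by
    unfold numBlocks
    have h2 : (e + A) / A ≤ (x.length + A - 1) / A := Nat.div_le_div_right (by omega)
    rw [Nat.add_div_right _ (by omega)] at h2
    omega
  have h2 := congrArg (fun z => z.getD (e % A) false) (hb _ h1)
  simp only [getD_block _ _ (Nat.mod_lt e (by omega : A > 0))] at h2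
  rwa [Nat.div_add_mod'] at h2

lemma eq_of_sum_modEq {s : Finset ℕ} {g g' : ℕ → ℕ} {Q j : ℕ} (hj : j ∈ s)
    (hne : ∀ i ∈ s, i ≠ j → g i = g' i) (hs : (∑ i ∈ s, g i) % Q = (∑ i ∈ s, g' i) % Q)
    (h1 : g j < Q) (h2 : g' j < Q) : g j = g' j := by
  rw [← Finset.add_sum_erase _ _ hj, ← Finset.add_sum_erase _ _ hj,
    Finset.sum_congr rfl fun i hi => hne i (Finset.mem_of_mem_erase hi) (Finset.ne_of_mem_erase hi)]
    at hs
  have := Nat.ModEq.add_right_cancel' _ (show Nat.ModEq _ _ _ from hs)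
  rwa [Nat.ModEq, Nat.mod_eq_of_lt h1, Nat.mod_eq_of_lt h2] at this

/-- The block hash recovers a string from a confusable one if they differ in a short window. -/
lemma eq_of_psi_eq {k : ℕ} {m : ℕ → ℕ} {φ : ℕ → List Bool → ℕ} (hφ : IsEditHash k m φ) {A : ℕ}
    (hA : 1 ≤ A) {x x' a w w' b : List Bool} (hc : Confusable k x x') (hx : x = a ++ w ++ b)
    (hx' : x' = a ++ w' ++ b) (hw : w.length = w'.length) (hwA : w.length ≤ A)
    (hψ : psi m φ A x = psi m φ A x') : x = x' := by
  have hout : ∀ i, (i + 1) * A ≤ a.length ∨ a.length + w.length ≤ i * A →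
      block A x i = block A x' i := by
    intro i hi
    refine eq_of_getD_eq (by simp [length_block]) fun e he => ?_
    rw [length_block] at he
    rw [getD_block _ _ he, getD_block _ _ he, hx, hx']
    rw [add_mul] at hi
    exact getD_window hw (by omega)
  set i₀ := a.length / A with hi₀
  have d1 : i₀ * A ≤ a.length := Nat.div_mul_le_self _ _
  have d2 : a.length < (i₀ + 1) * A := by
    rw [mul_comm]; exact Nat.lt_mul_div_succ _ (by omega)
  -- The window starts in block `i₀` and has length at most `A`, so it ends no later than block `i₀
  -- + 1`.
  have hfar : ∀ i, i ≠ i₀ → i ≠ i₀ + 1 → block A x i = block A x' i := by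
    intro i h1 h2
    refine hout i ?_
    rcases lt_or_ge i i₀ with h3 | h3
    · left
      exact (Nat.mul_le_mul_right A h3).trans d1
    · right
      have : (i₀ + 1 + 1) * A ≤ i * A := Nat.mul_le_mul_right A (by omega)
      rw [add_mul (i₀ + 1)] at this
      omega
  have hnb : numBlocks A x' = numBlocks A x := by rw [numBlocks, numBlocks, hc.1]
  simp only [psi, Prod.mk.injEq, hnb] at hψ
  have hlt : ∀ (z : List Bool) i, φ A (block A z i) < 2 ^ m A :=
    fun z i => hφ.lt_two_pow A _ (length_block A z i)
  refine eq_of_blocks_eq hA hc.1 fun i hi => ?_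
  by_cases hii : i = i₀ ∨ i = i₀ + 1
  · obtain ⟨y, hy1, hy2⟩ := (hc.block A i).2
    refine hφ.corrects A _ _ y (length_block _ _ _) (length_block _ _ _) hy1 hy2 ?_
    -- Only one of the two blocks has a given parity, so its hash is the only summand that may
    -- differ.
    rcases Nat.even_or_odd (i + 1) with hpar | hpar
    · refine eq_of_sum_modEq (g := fun i => φ A (block A x i)) (g' := fun i => φ A (block A x' i))
        (Finset.mem_filter.2 ⟨Finset.mem_range.2 hi, hpar⟩) (fun l hl hne => ?_) hψ.2
        (hlt x i) (hlt x' i)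
      rw [Finset.mem_filter] at hl
      have hlp := hl.2
      rw [Nat.even_iff] at hpar hlp
      exact congrArg (φ A) (hfar l (by omega) (by omega))
    · refine eq_of_sum_modEq (g := fun i => φ A (block A x i)) (g' := fun i => φ A (block A x' i))
        (Finset.mem_filter.2 ⟨Finset.mem_range.2 hi, hpar⟩) (fun l hl hne => ?_) hψ.1
        (hlt x i) (hlt x' i)
      rw [Finset.mem_filter] at hl
      have hlp := hl.2
      rw [Nat.odd_iff] at hpar hlp
      exact congrArg (φ A) (hfar l (by omega) (by omega))
  · push Not at hii
    exact hfar i hii.1 hii.2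

/-- The code corrects one `k`-substring edit. -/
theorem corrects_code {k : ℕ} (hk : 1 ≤ k) {m : ℕ → ℕ} {φ : ℕ → List Bool → ℕ}
    (hφ : IsEditHash k m φ) (n : ℕ) (δ : ℝ) (A : ℕ) (c₁ : ℕ × ℕ × ℕ) (c₂ : ℕ × ℕ)
    (hA : windowConst k * δ ^ 2 ≤ (A : ℝ)) : Corrects k (code k n δ m φ A c₁ c₂) := by
  rintro x ⟨hx, hd, hh, hψ⟩ x' ⟨hx', hd', hh', hψ'⟩ y hxy hxy'
  by_contra hxx
  obtain ⟨hδ, a, w, w', b, e1, e2, hw, hwl⟩ :=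
    exists_window hk hx hx' hd hd' (hh.trans hh'.symm) hxx hxy hxy'
  have hA1 : (0 : ℝ) < A := lt_of_lt_of_le
    (mul_pos (windowConst_pos k) (by positivity)) hA
  have hwA : w.length ≤ A := by exact_mod_cast hwl.trans hA
  exact hxx (eq_of_psi_eq hφ (by exact_mod_cast hA1) ⟨hx.trans hx'.symm, y, hxy, hxy'⟩ e1 e2 hw hwA
    (hψ.trans hψ'.symm))

/-! ### Finite sets of strings -/

/-- The strings of length `n`. -/
def strings : ℕ → Finset (List Bool)
  | 0 => {[]}
  | n + 1 => Finset.image₂ List.cons Finset.univ (strings n)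

lemma mem_strings {n : ℕ} {x : List Bool} : x ∈ strings n ↔ x.length = n := by
  induction n generalizing x with
  | zero => simp [strings]
  | succ n ih =>
    simp only [strings, Finset.mem_image₂, Finset.mem_univ, true_and, ih]
    constructor
    · rintro ⟨c, t, rfl, rfl⟩
      simp
    · intro hx
      cases x with
      | nil => simp at hx
      | cons c t => exact ⟨c, t, by simpa using hx, rfl⟩

lemma card_strings (n : ℕ) : (strings n).card = 2 ^ n := by
  induction n with
  | zero => simp [strings]
  | succ n ih =>
    rw [strings, Finset.card_image₂, ih]
    · simp [pow_succ, mul_comm]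
    · intro a b hab
      simp

/-- The strings of length at most `k`. -/
def shortStrings (k : ℕ) : Finset (List Bool) :=
  (Finset.range (k + 1)).biUnion strings

lemma mem_shortStrings {k : ℕ} {x : List Bool} : x ∈ shortStrings k ↔ x.length ≤ k := by
  simp [shortStrings, mem_strings]

/-! ### Existence of the hashes -/

/-- The strings that arise from a string `x` of length at most `l` by one edit. -/
def descendants (k l : ℕ) (x : List Bool) : Finset (List Bool) :=
  ((Finset.range (l + 1) ×ˢ Finset.range (k + 1)) ×ˢ shortStrings k).image
    fun p => x.take p.1.1 ++ p.2 ++ x.drop (p.1.1 + p.1.2)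

lemma mem_descendants {k l : ℕ} {x y : List Bool} (hl : x.length ≤ l)
    (hxy : SubstringEdit k x y) : y ∈ descendants k l x := by
  obtain ⟨a, u, v, b, hu, hv, rfl, rfl⟩ := hxy
  simp only [descendants, Finset.mem_image, Finset.mem_product, Finset.mem_range, mem_shortStrings]
  refine ⟨((a.length, u.length), v), ⟨⟨?_, by simp; omega⟩, hv⟩, ?_⟩
  · simp at hl ⊢
    omega
  · simp

lemma card_descendants_le (k l : ℕ) (x : List Bool) :
    (descendants k l x).card ≤ (l + 1) * (k + 1) * (shortStrings k).card := by
  refine Finset.card_image_le.trans ?_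
  simp

lemma SubstringEdit.symm {k : ℕ} {x y : List Bool} (hxy : SubstringEdit k x y) :
    SubstringEdit k y x := by
  obtain ⟨a, u, v, b, hu, hv, rfl, rfl⟩ := hxy
  exact ⟨a, v, u, b, hv, hu, rfl, rfl⟩

lemma SubstringEdit.length_le {k : ℕ} {x y : List Bool} (hxy : SubstringEdit k x y) :
    y.length ≤ x.length + k := by
  obtain ⟨a, u, v, b, hu, hv, rfl, rfl⟩ := hxy
  simp
  omega

/-- Greedy colouring: if every vertex has fewer than `Q` conflicts then `Q` colours suffice. -/
lemma exists_colouring {α : Type*} [DecidableEq α] (R : α → α → Prop) (conf : α → Finset α) {Q : ℕ}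
    (hR : ∀ a b, R a b → R b a) (T : Finset α) (hconf : ∀ a ∈ T, ∀ b, R a b → b ∈ conf a)
    (hQ : ∀ a, (conf a).card < Q) :
    ∃ φ : α → ℕ, (∀ a, φ a < Q) ∧ ∀ a ∈ T, ∀ b ∈ T, R a b → φ a = φ b → a = b := by
  induction T using Finset.induction_on with
  | empty =>
    by_cases hα : Nonempty α
    · obtain ⟨a⟩ := hα
      exact ⟨fun _ => 0, fun _ => (Nat.zero_le _).trans_lt (hQ a), by simp⟩
    · exact ⟨fun _ => 0, fun a => (hα ⟨a⟩).elim, by simp⟩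
  | insert a T ha ih =>
    obtain ⟨φ, h1, h2⟩ := ih fun a ha => hconf a (by simp [ha])
    obtain ⟨c, hc, hcn⟩ : ∃ c ∈ Finset.range Q, c ∉ (conf a).image φ := by
      apply Finset.exists_mem_notMem_of_card_lt_card
      rw [Finset.card_range]
      exact Finset.card_image_le.trans_lt (hQ a)
    have hcn' : ∀ b, R a b → φ b ≠ c := by
      intro b hb hbc
      exact hcn (Finset.mem_image.2 ⟨b, hconf a (by simp) b hb, hbc⟩)
    refine ⟨Function.update φ a c, fun b => ?_, ?_⟩
    · by_cases hb : b = a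
      · subst hb
        simpa using hc
      · simpa [hb] using h1 b
    · intro b hb b' hb' hbb hφ
      rw [Finset.mem_insert] at hb hb'
      by_cases e1 : b = a <;> by_cases e2 : b' = a
      · rw [e1, e2]
      · subst e1
        rw [Function.update_self, Function.update_of_ne e2] at hφ
        exact (hcn' b' hbb hφ.symm).elim
      · subst e2
        rw [Function.update_self, Function.update_of_ne e1] at hφ
        exact (hcn' b (hR _ _ hbb) hφ).elim
      · rw [Function.update_of_ne e1, Function.update_of_ne e2] at hφ
        exact h2 b (hb.resolve_left e1) b' (hb'.resolve_left e2) hbb hφ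

lemma tendsto_logb_two_natCast : Tendsto (fun n : ℕ => Real.logb 2 (n : ℝ)) atTop atTop :=
  (Real.tendsto_logb_atTop (by norm_num)).comp tendsto_natCast_atTop_atTop

/-- Hashes with the required properties exist. -/
theorem exists_isEditHash {k : ℕ} (hk : 1 ≤ k) :
    ∃ (m : ℕ → ℕ) (φ : ℕ → List Bool → ℕ), IsEditHash k m φ := by
  set V := (shortStrings k).card
  set D := (k + 1) ^ 3 * V ^ 2 with hD
  -- A string has at most `(A + 1)² D` conflicts, and `4D < 2^{4D}` absorbs the constant factor.
  let m : ℕ → ℕ := fun A => 2 * Nat.log 2 A + 4 * D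
  have hcol : ∀ A : ℕ, ∃ φ : List Bool → ℕ, (∀ r, φ r < 2 ^ m A) ∧
      ∀ r ∈ strings A, ∀ r' ∈ strings A,
        (∃ s, SubstringEdit k r s ∧ SubstringEdit k r' s) → φ r = φ r' → r = r' := by
    intro A
    -- Edits are reversible, so the conflicts of `r` are among the descendants of its descendants.
    refine exists_colouring (fun r r' => ∃ s, SubstringEdit k r s ∧ SubstringEdit k r' s)
      (fun r => (descendants k A r).biUnion (descendants k (A + k))) ?_ _ ?_ ?_
    · rintro r r' ⟨s, h1, h2⟩
      exact ⟨s, h2, h1⟩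
    · rintro r hr r' ⟨s, h1, h2⟩
      rw [mem_strings] at hr
      rw [Finset.mem_biUnion]
      exact ⟨s, mem_descendants hr.le h1, mem_descendants (by rw [← hr]; exact h1.length_le) h2.symm⟩
    · intro r
      have h1 : ((descendants k A r).biUnion (descendants k (A + k))).card ≤
          (descendants k A r).card * ((A + k + 1) * (k + 1) * V) :=
        Finset.card_biUnion_le_card_mul _ _ _ fun s _ => card_descendants_le k (A + k) s
      have h2 := Nat.mul_le_mul_right ((A + k + 1) * (k + 1) * V) (card_descendants_le k A r)
      have h3 : (A + 1) * (k + 1) * V * ((A + k + 1) * (k + 1) * V) ≤ (A + 1) ^ 2 * D := by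
        have : A + k + 1 ≤ (A + 1) * (k + 1) := by nlinarith [Nat.zero_le (A * k)]
        calc (A + 1) * (k + 1) * V * ((A + k + 1) * (k + 1) * V)
            ≤ (A + 1) * (k + 1) * V * ((A + 1) * (k + 1) * (k + 1) * V) := by gcongr
          _ = (A + 1) ^ 2 * D := by rw [hD]; ring
      have h4 : A + 1 ≤ 2 ^ (Nat.log 2 A + 1) := Nat.lt_pow_succ_log_self (by norm_num) A
      have h5 : (A + 1) ^ 2 * D ≤ (2 ^ (Nat.log 2 A + 1)) ^ 2 * D := by gcongr
      have h6 : 4 * D < 2 ^ (4 * D) := Nat.lt_two_pow_self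
      have h7 : (2 ^ (Nat.log 2 A + 1)) ^ 2 * D = 2 ^ (2 * Nat.log 2 A) * (4 * D) := by
        rw [← pow_mul, show (Nat.log 2 A + 1) * 2 = 2 * Nat.log 2 A + 2 by ring, pow_add]
        ring
      have h8 : 2 ^ (2 * Nat.log 2 A) * (4 * D) < 2 ^ m A := by
        simp only [m]
        rw [pow_add]
        exact Nat.mul_lt_mul_of_pos_left h6 (by positivity)
      exact (h1.trans (h2.trans (h3.trans (h5.trans h7.le)))).trans_lt h8
  choose φ h1 h2 using hcol
  refine ⟨m, φ, fun A r _ => h1 A r, fun A r r' s hr hr' hs hs' he =>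
    h2 A r (mem_strings.2 hr) r' (mem_strings.2 hr') ⟨s, hs, hs'⟩ he,
    fun _ => ((4 * D : ℕ) : ℝ), ?_, fun A => ?_⟩
  · exact isLittleO_const_left.2
      (Or.inr (tendsto_norm_atTop_atTop.comp tendsto_logb_two_natCast))
  · have e1 : (Nat.log 2 A : ℝ) ≤ Real.logb 2 A := by exact_mod_cast Real.natLog_le_logb A 2
    have e2 : (0 : ℝ) ≤ Nat.log 2 A := by positivity
    have e3 : (1 : ℝ) ≤ k := by exact_mod_cast hk
    simp only [m]
    push_cast
    nlinarith

/-! ### Counting dense strings -/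

lemma occ_first_part {k : ℕ} : ∀ {t q : List Bool} {qs : List (List Bool)},
    parts k t = q :: qs → occ (pattern k) q = 0 := by
  intro t
  induction t with
  | nil =>
    intro q qs hq
    simp [parts] at hq
    rw [hq.1, occ_nil]
  | cons c t ih =>
    intro q qs hq
    obtain ⟨q', qs', hq'⟩ := List.exists_cons_of_ne_nil (parts_ne_nil k t)
    rw [parts_cons hq'] at hq
    split_ifs at hq with hp
    · simp at hq
      rw [hq.1, occ_nil]
    · simp at hq
      rw [← hq.1, occ_cons, ih hq', if_neg]
      intro hpq
      apply hp
      have := flatten_parts k t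
      rw [hq', List.flatten_cons] at this
      exact hpq.trans ⟨qs'.flatten, by rw [List.cons_append, this]⟩

/-- An occurrence later in a part would have been a cut; removing the first bit destroys the only
possible one. -/
lemma occ_tail_part {k : ℕ} (x : List Bool) : ∀ q ∈ parts k x, occ (pattern k) q.tail = 0 := by
  induction x with
  | nil => simp [parts, occ_nil]
  | cons c t ih =>
    obtain ⟨q', qs', hq'⟩ := List.exists_cons_of_ne_nil (parts_ne_nil k t)
    have h0 := occ_first_part hq'
    rw [hq'] at ih
    rw [parts_cons hq']
    split_ifs
    · simp only [List.mem_cons, forall_eq_or_imp] at ih ⊢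
      exact ⟨by simp [occ_nil], by simpa using h0, ih.2⟩
    · simp only [List.mem_cons, forall_eq_or_imp] at ih ⊢
      exact ⟨by simpa using h0, ih.2⟩

/-- The strings of length `2kT` none of whose `T` aligned blocks of length `2k` is the pattern. -/
def avoiding (k : ℕ) : ℕ → Finset (List Bool)
  | 0 => {[]}
  | T + 1 => Finset.image₂ (· ++ ·) ((strings (2 * k)).erase (pattern k)) (avoiding k T)

lemma card_avoiding_le (k T : ℕ) : (avoiding k T).card ≤ (2 ^ (2 * k) - 1) ^ T := by
  induction T with
  | zero => simp [avoiding]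
  | succ T ih =>
    refine (Finset.card_image₂_le _ _ _).trans ?_
    rw [Finset.card_erase_of_mem (mem_strings.2 (pattern_length k)), card_strings, pow_succ,
      mul_comm]
    exact Nat.mul_le_mul_right _ ih

lemma occ_self {w : List Bool} (hw : w ≠ []) : 1 ≤ occ w w := by
  rw [occ, Nat.one_le_iff_ne_zero, Finset.card_ne_zero]
  exact ⟨0, by simpa using List.length_pos_iff.2 hw⟩

lemma mem_avoiding {k : ℕ} (hk : 1 ≤ k) {T : ℕ} {z : List Bool} (hz : z.length = 2 * k * T)
    (ho : occ (pattern k) z = 0) : z ∈ avoiding k T := by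
  induction T generalizing z with
  | zero => simpa [avoiding] using hz
  | succ T ih =>
    rw [mul_add, mul_one] at hz
    have h1 := le_occ_append (pattern k) (z.take (2 * k)) (z.drop (2 * k))
    rw [List.take_append_drop, ho] at h1
    refine Finset.mem_image₂.2 ⟨z.take (2 * k), ?_, z.drop (2 * k), ih (by simp [hz]) (by omega),
      List.take_append_drop _ _⟩
    rw [Finset.mem_erase, mem_strings]
    refine ⟨fun he => ?_, by simp [hz]⟩
    rw [he] at h1
    have := occ_self (w := pattern k) (by
      rw [← List.length_pos_iff, pattern_length]; omega)
    omega

open Classical in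
/-- The strings of length `n` that are not dense. -/
noncomputable def sparse (k n : ℕ) (δ : ℝ) : Finset (List Bool) :=
  (strings n).filter fun x => ¬ Dense k δ x

lemma mem_sparse {k n : ℕ} {δ : ℝ} {x : List Bool} :
    x ∈ sparse k n δ ↔ x.length = n ∧ ¬ Dense k δ x := by
  simp [sparse, mem_strings]

/-- Union bound over the start of a long part: the `2kT` bits after its first bit avoid the pattern
in each of `T` aligned blocks, which leaves `(2^{2k} - 1)^T` choices instead of `2^{2kT}`. -/
lemma card_sparse_le {k : ℕ} (hk : 1 ≤ k) (n T : ℕ) {δ : ℝ} (hT : (2 * k * T : ℝ) ≤ δ) :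
    (sparse k n δ).card * 2 ^ (2 * k * T) ≤ n * (2 ^ n * (2 ^ (2 * k) - 1) ^ T) := by
  set I := (Finset.range n).filter fun i => i + 1 + 2 * k * T ≤ n with hI
  let S : ℕ → Finset (List Bool) := fun i =>
    ((strings (i + 1) ×ˢ avoiding k T) ×ˢ strings (n - (i + 1) - 2 * k * T)).image
      fun p => p.1.1 ++ p.1.2 ++ p.2
  have hsub : sparse k n δ ⊆ I.biUnion S := by
    intro x hx
    rw [mem_sparse, Dense] at hx
    obtain ⟨hxn, hx⟩ := hx
    push Not at hx
    obtain ⟨q, hq, hqδ⟩ := hx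
    have hql : 2 * k * T < q.length := by exact_mod_cast hT.trans_lt hqδ
    obtain ⟨c, q, rfl⟩ := List.exists_cons_of_length_pos (by omega : 0 < q.length)
    have ho := occ_tail_part x _ hq
    rw [List.tail_cons] at ho
    obtain ⟨P, S', hPS⟩ := List.append_of_mem hq
    have hxe := flatten_parts k x
    rw [hPS, List.flatten_append, List.flatten_cons] at hxe
    have hlen := congrArg List.length hxe
    simp only [List.length_append, List.length_cons, hxn] at hlen hql
    rw [Finset.mem_biUnion]
    refine ⟨P.flatten.length, ?_, ?_⟩
    · simp only [hI, Finset.mem_filter, Finset.mem_range]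
      omega
    · refine Finset.mem_image.2 ⟨((P.flatten ++ [c], q.take (2 * k * T)),
        q.drop (2 * k * T) ++ S'.flatten), ?_, ?_⟩
      · simp only [Finset.mem_product, mem_strings]
        refine ⟨⟨by simp, mem_avoiding hk (by simp; omega) ?_⟩, ?_⟩
        · have h1 := le_occ_append (pattern k) (q.take (2 * k * T)) (q.drop (2 * k * T))
          rw [List.take_append_drop, ho] at h1
          omega
        · simp only [List.length_append, List.length_drop]
          omega
      · rw [← hxe]
        simp only [List.append_assoc, List.cons_append, List.nil_append,
          List.append_cancel_left_eq, List.cons.injEq, true_and]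
        rw [← List.append_assoc, List.take_append_drop]
  have hS : ∀ i ∈ I, (S i).card * 2 ^ (2 * k * T) ≤ 2 ^ n * (2 ^ (2 * k) - 1) ^ T := by
    intro i hi
    simp only [hI, Finset.mem_filter, Finset.mem_range] at hi
    have h1 : (S i).card ≤ 2 ^ (i + 1) * (avoiding k T).card * 2 ^ (n - (i + 1) - 2 * k * T) := by
      refine Finset.card_image_le.trans ?_
      simp [card_strings]
    calc (S i).card * 2 ^ (2 * k * T)
        ≤ 2 ^ (i + 1) * (avoiding k T).card * 2 ^ (n - (i + 1) - 2 * k * T) * 2 ^ (2 * k * T) :=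
          Nat.mul_le_mul_right _ h1
      _ = 2 ^ (i + 1 + (n - (i + 1) - 2 * k * T) + 2 * k * T) * (avoiding k T).card := by
          rw [pow_add _ _ (2 * k * T), pow_add _ (i + 1)]; ring
      _ = 2 ^ n * (avoiding k T).card := by congr 2; omega
      _ ≤ _ := Nat.mul_le_mul_left _ (card_avoiding_le k T)
  calc (sparse k n δ).card * 2 ^ (2 * k * T)
      ≤ (∑ i ∈ I, (S i).card) * 2 ^ (2 * k * T) :=
        Nat.mul_le_mul_right _ ((Finset.card_le_card hsub).trans Finset.card_biUnion_le)
    _ ≤ I.card * (2 ^ n * (2 ^ (2 * k) - 1) ^ T) := by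
        rw [Finset.sum_mul]
        simpa using Finset.sum_le_card_nsmul I _ _ hS
    _ ≤ _ := Nat.mul_le_mul_right _ (by simpa using Finset.card_filter_le (Finset.range n) _)

/-- With `T = ⌊4·2^{2k} log n⌋`, `(1 - 2^{-2k})^T ≤ e / n^4`, where the factor `e` pays for the
floor. The sparse fraction is thus at most `e / n^3 ≤ e / 8`. -/
lemma two_mul_card_sparse_le {k n : ℕ} (hk : 1 ≤ k) (hn : 2 ≤ n) :
    2 * (sparse k n (delta k n)).card ≤ 2 ^ n := by
  have hn' : (2 : ℝ) ≤ n := by exact_mod_cast hn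
  have hk' : (1 : ℝ) ≤ k := by exact_mod_cast hk
  have hlog : Real.log n ≤ Real.logb 2 n := by
    rw [Real.logb, le_div_iff₀ (Real.log_pos (by norm_num))]
    have := Real.log_nonneg (by linarith : (1 : ℝ) ≤ n)
    have := Real.log_two_lt_d9
    nlinarith
  have hlog0 := Real.log_nonneg (by linarith : (1 : ℝ) ≤ n)
  set a : ℝ := 2 ^ (2 * k) with ha
  have ha1 : 1 ≤ a := one_le_pow₀ (by norm_num)
  have ha4 : 4 ≤ a := by
    calc (4 : ℝ) = 2 ^ 2 := by norm_num
      _ ≤ a := pow_le_pow_right₀ (by norm_num) (by omega)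
  have hδ : delta k n = 2 * k * (4 * a * Real.logb 2 n) := by
    rw [delta, pow_add]; ring
  set T := ⌊4 * a * Real.logb 2 n⌋₊ with hT
  have hx0 : 0 ≤ 4 * a * Real.logb 2 n := by
    have : 0 ≤ Real.logb 2 n := hlog0.trans hlog
    positivity
  have hTδ : (2 * k * T : ℝ) ≤ delta k n := by
    rw [hδ]
    exact mul_le_mul_of_nonneg_left (Nat.floor_le hx0) (by positivity)
  have hTlow : 4 * a * Real.log n - 1 ≤ T := by
    have := Nat.lt_floor_add_one (4 * a * Real.logb 2 n)
    have : 4 * a * Real.log n ≤ 4 * a * Real.logb 2 n :=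
      mul_le_mul_of_nonneg_left hlog (by positivity)
    linarith
  have h1 : ((sparse k n (delta k n)).card : ℝ) * a ^ T ≤ n * (2 ^ n * (a - 1) ^ T) := by
    have := card_sparse_le hk n T hTδ
    have hc : ((2 ^ (2 * k) - 1 : ℕ) : ℝ) = a - 1 := by
      rw [Nat.cast_sub Nat.one_le_two_pow]; simp [ha]
    rw [ha, ← pow_mul, ← ha, ← hc]
    exact_mod_cast this
  have h2 : (a - 1) ^ T ≤ a ^ T * (Real.exp 1 / n ^ 4) := by
    have e1 : a - 1 ≤ a * Real.exp (-(1 / a)) := by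
      have := Real.add_one_le_exp (-(1 / a))
      have e : a - 1 = a * (-(1 / a) + 1) := by field_simp; ring
      rw [e]
      exact mul_le_mul_of_nonneg_left this (by positivity)
    calc (a - 1) ^ T ≤ (a * Real.exp (-(1 / a))) ^ T := pow_le_pow_left₀ (by linarith) e1 T
      _ = a ^ T * Real.exp (-(T / a)) := by
          rw [mul_pow, ← Real.exp_nat_mul]
          congr 2
          ring
      _ ≤ a ^ T * (Real.exp 1 / n ^ 4) := by
          refine mul_le_mul_of_nonneg_left ?_ (by positivity)
          have e2 : Real.exp 1 / (n : ℝ) ^ 4 = Real.exp (1 - 4 * Real.log n) := by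
            rw [Real.exp_sub]
            congr 1
            rw [show (4 : ℝ) * Real.log n = ((4 : ℕ) : ℝ) * Real.log n by norm_num,
              Real.exp_nat_mul, Real.exp_log (by linarith)]
          rw [e2]
          refine Real.exp_le_exp.2 ?_
          have e3 : 4 * Real.log n - 1 ≤ T / a := by
            rw [le_div_iff₀ (by linarith)]
            nlinarith
          linarith
  have h3 : (n : ℝ) * (Real.exp 1 / n ^ 4) ≤ 1 / 2 := by
    have e1 := Real.exp_one_lt_d9
    have e2 : (8 : ℝ) ≤ n ^ 3 := by
      calc (8 : ℝ) = 2 ^ 3 := by norm_num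
        _ ≤ n ^ 3 := pow_le_pow_left₀ (by norm_num) hn' 3
    have e3 : (n : ℝ) * (Real.exp 1 / n ^ 4) = Real.exp 1 / n ^ 3 := by
      field_simp
    rw [e3, div_le_iff₀ (by positivity)]
    linarith
  have h4 : ((sparse k n (delta k n)).card : ℝ) * a ^ T ≤ (2 ^ n * (1 / 2)) * a ^ T := by
    calc _ ≤ n * (2 ^ n * (a - 1) ^ T) := h1
      _ ≤ n * (2 ^ n * (a ^ T * (Real.exp 1 / n ^ 4))) := by gcongr
      _ = 2 ^ n * (n * (Real.exp 1 / n ^ 4)) * a ^ T := by ring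
      _ ≤ _ := by gcongr
  have h5 := le_of_mul_le_mul_right h4 (by positivity)
  have h6 : (2 : ℝ) * (sparse k n (delta k n)).card ≤ 2 ^ n := by linarith
  exact_mod_cast h6

lemma finite_code (k n : ℕ) (δ : ℝ) (m : ℕ → ℕ) (φ : ℕ → List Bool → ℕ) (A : ℕ)
    (c₁ : ℕ × ℕ × ℕ) (c₂ : ℕ × ℕ) : (code k n δ m φ A c₁ c₂).Finite :=
  (strings n).finite_toSet.subset fun _ hx => mem_strings.2 hx.1

/-- For suitable hash values the code is large. -/
lemma exists_large_code {k n : ℕ} (hk : 1 ≤ k) (hn : 2 ≤ n) (m : ℕ → ℕ)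
    (φ : ℕ → List Bool → ℕ) (A : ℕ) : ∃ c₁ c₂,
    (2 : ℝ) ^ n ≤ 2 * (2000 * C k * n * (10 * C k * k) * 5 * (2 ^ m A * 2 ^ m A)) *
      (code k n (delta k n) m φ A c₁ c₂).ncard := by
  classical
  set s := (strings n).filter fun x => Dense k (delta k n) x with hs
  set t := (Finset.range (2000 * C k * n) ×ˢ Finset.range (10 * C k * k) ×ˢ Finset.range 5) ×ˢ
    (Finset.range (2 ^ m A) ×ˢ Finset.range (2 ^ m A)) with ht
  have hC : 0 < C k := by unfold C; positivity
  have hmaps : ∀ x ∈ s, (h k n x, psi m φ A x) ∈ t := by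
    intro x _
    simp only [ht, h, psi, Finset.mem_product, Finset.mem_range]
    exact ⟨⟨Nat.mod_lt _ (by positivity), Nat.mod_lt _ (by positivity), Nat.mod_lt _ (by norm_num)⟩,
      Nat.mod_lt _ (by positivity), Nat.mod_lt _ (by positivity)⟩
  have htne : t.Nonempty := by
    refine ⟨((0, 0, 0), (0, 0)), ?_⟩
    simp only [ht, Finset.mem_product, Finset.mem_range]
    refine ⟨⟨?_, ?_, ?_⟩, ?_, ?_⟩ <;> positivity
  have hcard : (2 : ℝ) ^ n ≤ 2 * s.card := by
    have h1 := two_mul_card_sparse_le hk hn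
    have h2 : (sparse k n (delta k n)).card + s.card = 2 ^ n := by
      rw [← card_strings, add_comm, sparse, hs]
      convert Finset.card_filter_add_card_filter_not (s := strings n)
        (fun x => Dense k (delta k n) x)
    have h3 : 2 ^ n ≤ 2 * s.card := by omega
    exact_mod_cast h3
  have htc : (t.card : ℝ) = 2000 * C k * n * (10 * C k * k) * 5 * (2 ^ m A * 2 ^ m A) := by
    rw [ht]
    simp only [Finset.card_product, Finset.card_range]
    push_cast
    ring
  have htpos : (0 : ℝ) < t.card := by exact_mod_cast htne.card_pos
  obtain ⟨⟨c₁, c₂⟩, _, hc⟩ := Finset.exists_le_card_fiber_of_nsmul_le_card_of_maps_to hmaps htne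
    (b := (s.card : ℝ) / t.card) (by rw [nsmul_eq_mul]; exact (mul_div_cancel₀ _ htpos.ne').le)
  refine ⟨c₁, c₂, ?_⟩
  rw [← htc]
  have hle : (s.filter fun x => (h k n x, psi m φ A x) = (c₁, c₂)).card ≤
      (code k n (delta k n) m φ A c₁ c₂).ncard := by
    rw [← Set.ncard_coe_finset]
    refine Set.ncard_le_ncard (fun x hx => ?_) (finite_code _ _ _ _ _ _ _ _)
    simp only [hs, Finset.mem_coe, Finset.mem_filter, mem_strings, Prod.mk.injEq] at hx
    exact ⟨hx.1.1, hx.1.2, hx.2.1, hx.2.2⟩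
  rw [div_le_iff₀ htpos] at hc
  have hle' : ((s.filter fun x => (h k n x, psi m φ A x) = (c₁, c₂)).card : ℝ) ≤
      (code k n (delta k n) m φ A c₁ c₂).ncard := by exact_mod_cast hle
  nlinarith

/-! ### The lower bound on the redundancy -/

lemma substringEdit_set {k : ℕ} (hk : 1 ≤ k) (x : List Bool) (i : ℕ) (c : Bool) :
    SubstringEdit k x (x.set i c) := by
  by_cases hi : i < x.length
  · refine ⟨x.take i, [x[i]], [c], x.drop (i + 1), by simpa, by simpa, by simp, ?_⟩
    rw [List.set_eq_take_append_cons_drop, if_pos hi]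
    simp
  · rw [List.set_eq_of_length_le (by omega)]
    exact ⟨x, [], [], [], by simp, by simp, by simp, by simp⟩

/-- The sphere-packing bound for one substitution. -/
lemma ncard_mul_le_of_corrects {k n : ℕ} (hk : 1 ≤ k) {D : Set (List Bool)}
    (hD : ∀ x ∈ D, x.length = n) (hc : Corrects k D) : D.ncard * (n + 1) ≤ 2 ^ n := by
  have hfin : D.Finite := (strings n).finite_toSet.subset fun x hx => mem_strings.2 (hD x hx)
  have hmemD : ∀ x, x ∈ hfin.toFinset ↔ x ∈ D := fun x => hfin.mem_toFinset
  rw [Set.ncard_eq_toFinset_card D hfin, ← Finset.card_range (n + 1), ← Finset.card_product,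
    ← card_strings]
  -- Index `i < n` flips a bit, while `i = n` is out of range and returns the codeword itself: `n +
  -- 1` words per codeword.
  refine Finset.card_le_card_of_injOn (fun p => p.1.set p.2 (!p.1.getD p.2 false)) ?_ ?_
  · rintro ⟨x, i⟩ hp
    simp only [Finset.coe_product, Set.mem_prod, Finset.mem_coe, hmemD] at hp
    simp [mem_strings, hD x hp.1]
  · rintro ⟨x, i⟩ hp ⟨x', i'⟩ hp' he
    simp only [Finset.coe_product, Set.mem_prod, Finset.mem_coe, hmemD, Finset.mem_range] at hp hp'
    simp only at he
    have hxx : x = x' := hc x hp.1 x' hp'.1 _ (substringEdit_set hk x i _)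
      (by rw [he]; exact substringEdit_set hk x' i' _)
    subst hxx
    have hx := hD x hp.1
    have key : ∀ i i', i < n → i ≠ i' →
        x.set i (!x.getD i false) ≠ x.set i' (!x.getD i' false) := by
      intro i i' hi hii hee
      have := congrArg (fun z => z.getD i false) hee
      simp [List.getD, hx, hi, hii.symm] at this
    congr 1
    by_contra hii
    by_cases h1 : i < n
    · exact key i i' h1 hii he
    · exact key i' i (by omega) (Ne.symm hii) he.symm

lemma logb_le_redundancy {k n : ℕ} (hk : 1 ≤ k) {D : Set (List Bool)} (hne : D.Nonempty)
    (hD : ∀ x ∈ D, x.length = n) (hc : Corrects k D) :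
    Real.logb 2 (n + 1) ≤ redundancy n D := by
  have hfin : D.Finite := (strings n).finite_toSet.subset fun x hx => mem_strings.2 (hD x hx)
  have hpos : (0 : ℝ) < D.ncard := by exact_mod_cast (Set.ncard_pos hfin).2 hne
  have h1 : (D.ncard : ℝ) * (n + 1) ≤ 2 ^ n := by exact_mod_cast ncard_mul_le_of_corrects hk hD hc
  have h2 := Real.logb_le_logb_of_le (b := 2) (by norm_num) (by positivity) h1
  rw [Real.logb_mul hpos.ne' (by positivity), Real.logb_pow, Real.logb_self_eq_one (by norm_num)]
    at h2
  unfold redundancy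
  linarith

/-! ### Asymptotics -/

lemma tendsto_logb_logb : Tendsto (fun n : ℕ => Real.logb 2 (Real.logb 2 (n : ℝ))) atTop atTop :=
  (Real.tendsto_logb_atTop (by norm_num)).comp tendsto_logb_two_natCast

lemma logb_logb_isLittleO :
    (fun n : ℕ => Real.logb 2 (Real.logb 2 (n : ℝ))) =o[atTop] fun n : ℕ => Real.logb 2 (n : ℝ) := by
  have h1 : (fun y : ℝ => Real.logb 2 y) =o[atTop] fun y : ℝ => y := by
    have := Real.isLittleO_log_id_atTop.const_mul_left (Real.log 2)⁻¹
    refine this.congr_left fun y => ?_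
    rw [Real.logb, div_eq_inv_mul]
  exact h1.comp_tendsto tendsto_logb_two_natCast

lemma isBigO_of_le_add_mul {u g : ℕ → ℝ} {a b : ℝ} (hg : Tendsto g atTop atTop)
    (h0 : ∀ᶠ n in atTop, 0 ≤ u n) (hu : ∀ᶠ n in atTop, u n ≤ a + b * g n) : u =O[atTop] g := by
  refine IsBigO.of_bound (|a| + b) ?_
  filter_upwards [h0, hu, hg.eventually_ge_atTop 1] with n h1 h2 h3
  rw [Real.norm_of_nonneg h1, Real.norm_of_nonneg (by linarith)]
  have := le_abs_self a
  have := mul_le_mul_of_nonneg_left h3 (abs_nonneg a)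
  linarith

/-- The hash length for blocks of length `A n` is `O(log log n)`. -/
lemma exists_hash_length_le {k : ℕ} (hk : 1 ≤ k) {m : ℕ → ℕ} {φ : ℕ → List Bool → ℕ}
    (hφ : IsEditHash k m φ) {A : ℕ → ℕ} {K : ℝ} (hK : 0 < K)
    (hA : ∀ n : ℕ, K * delta k n ^ 2 ≤ (A n : ℝ))
    (hA' : (fun n : ℕ => (A n : ℝ)) =O[atTop] fun n : ℕ => delta k n ^ 2) :
    ∃ a b : ℝ,
      ∀ᶠ n : ℕ in atTop, (m (A n) : ℝ) ≤ a + b * Real.logb 2 (Real.logb 2 (n : ℝ)) := by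
  obtain ⟨e, he, hm⟩ := hφ.size
  obtain ⟨c, hc, hAc⟩ := hA'.exists_pos
  have hκ : (0 : ℝ) < k * 2 ^ (2 * k + 3) := by positivity
  have hδ : Tendsto (fun n : ℕ => delta k n) atTop atTop :=
    tendsto_logb_two_natCast.const_mul_atTop hκ
  have hAt : Tendsto A atTop atTop := by
    rw [← tendsto_natCast_atTop_iff (R := ℝ)]
    refine tendsto_atTop_mono hA ?_
    exact ((tendsto_pow_atTop (by norm_num)).comp hδ).const_mul_atTop hK
  -- The lower bound on `A` makes it tend to infinity, so the `o(log A)` term is eventually at most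
  -- `log A`.
  have he' := hAt.eventually (he.bound (by norm_num : (0 : ℝ) < 1))
  refine ⟨(4 * k + 1) * (Real.logb 2 c + 2 * Real.logb 2 (k * 2 ^ (2 * k + 3))), (4 * k + 1) * 2,
    ?_⟩
  filter_upwards [he', hAc.bound, hAt.eventually_ge_atTop 1,
    tendsto_logb_two_natCast.eventually_ge_atTop 1] with n h1 h2 h3 h4
  have hA1 : (1 : ℝ) ≤ A n := by exact_mod_cast h3
  have hlA : 0 ≤ Real.logb 2 (A n) := Real.logb_nonneg (by norm_num) hA1
  have h5 : e (A n) ≤ Real.logb 2 (A n) := by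
    rw [Real.norm_of_nonneg hlA, one_mul] at h1
    exact (le_abs_self _).trans h1
  have h6 : (A n : ℝ) ≤ c * (k * 2 ^ (2 * k + 3) * Real.logb 2 n) ^ 2 := by
    rw [Real.norm_of_nonneg (by positivity), Real.norm_of_nonneg (by positivity)] at h2
    exact h2
  have h7 : Real.logb 2 (A n) ≤ Real.logb 2 c + 2 * Real.logb 2 (k * 2 ^ (2 * k + 3)) +
      2 * Real.logb 2 (Real.logb 2 n) := by
    refine (Real.logb_le_logb_of_le (by norm_num) (by linarith) h6).trans (le_of_eq ?_)
    rw [Real.logb_mul hc.ne' (by positivity), Real.logb_pow,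
      Real.logb_mul hκ.ne' (by positivity)]
    push_cast
    ring
  have h8 := hm (A n)
  have h9 : (m (A n) : ℝ) ≤ (4 * k + 1) * Real.logb 2 (A n) := by linarith
  have h10 := mul_le_mul_of_nonneg_left h7 (by positivity : (0 : ℝ) ≤ 4 * k + 1)
  linarith

lemma redundancy_le_of_large {k n M N : ℕ} (hk : 1 ≤ k) (hn : 2 ≤ n)
    (hN : (2 : ℝ) ^ n ≤ 2 * (2000 * C k * n * (10 * C k * k) * 5 * (2 ^ M * 2 ^ M)) * N) :
    (n : ℝ) - Real.logb 2 N ≤ Real.logb 2 n + Real.logb 2 (200000 * C k * C k * k) + 2 * M := by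
  have hC : (0 : ℝ) < C k := by unfold C; positivity
  have hk' : (0 : ℝ) < k := by positivity
  have hn' : (0 : ℝ) < n := by positivity
  have hN0 : (0 : ℝ) < N := by
    rcases Nat.eq_zero_or_pos N with h0 | h0
    · rw [h0, Nat.cast_zero, mul_zero] at hN
      exact absurd hN (not_le.2 (by positivity))
    · exact_mod_cast h0
  have h1 : (2 : ℝ) ^ n ≤ n * (200000 * C k * C k * k) * 2 ^ (2 * M) * N := by
    refine hN.trans (le_of_eq ?_)
    rw [two_mul M, pow_add]
    ring
  have h2 := Real.logb_le_logb_of_le (b := 2) (by norm_num) (by positivity) h1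
  rw [Real.logb_mul (by positivity) hN0.ne', Real.logb_mul (by positivity) (by positivity),
    Real.logb_mul hn'.ne' (by positivity), Real.logb_pow, Real.logb_pow,
    Real.logb_self_eq_one (by norm_num)] at h2
  push_cast at h2
  linarith

/-- The redundancy of the code for suitable hash values. -/
theorem redundancy_asymptotics {k : ℕ} (hk : 1 ≤ k) {m : ℕ → ℕ} {φ : ℕ → List Bool → ℕ}
    (hφ : IsEditHash k m φ) {A : ℕ → ℕ} (hA : ∀ n : ℕ, windowConst k * delta k n ^ 2 ≤ (A n : ℝ))
    (hA' : (fun n : ℕ => (A n : ℝ)) =O[atTop] fun n : ℕ => delta k n ^ 2) :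
    ∃ (c₁ : ℕ → ℕ × ℕ × ℕ) (c₂ : ℕ → ℕ × ℕ) (r : ℕ → ℝ),
      (∀ n : ℕ, r n = redundancy n (code k n (delta k n) m φ (A n) (c₁ n) (c₂ n))) ∧
      ((fun n : ℕ => r n - Real.logb 2 (n : ℝ)) =O[atTop]
        fun n : ℕ => Real.logb 2 (Real.logb 2 (n : ℝ))) ∧
      ((fun n : ℕ => r n - optRedundancy k n) =O[atTop]
        fun n : ℕ => Real.logb 2 (Real.logb 2 (n : ℝ))) ∧
      Tendsto (fun n : ℕ => r n / optRedundancy k n) atTop (nhds 1) := by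
  have hex : ∀ n : ℕ, ∃ (c₁ : ℕ × ℕ × ℕ) (c₂ : ℕ × ℕ), 2 ≤ n →
      (2 : ℝ) ^ n ≤ 2 * (2000 * C k * n * (10 * C k * k) * 5 * (2 ^ m (A n) * 2 ^ m (A n))) *
        (code k n (delta k n) m φ (A n) c₁ c₂).ncard := by
    intro n
    by_cases hn : 2 ≤ n
    · obtain ⟨c₁, c₂, hc⟩ := exists_large_code hk hn m φ (A n)
      exact ⟨c₁, c₂, fun _ => hc⟩
    · exact ⟨(0, 0, 0), (0, 0), fun hn' => absurd hn' hn⟩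
  choose c₁ c₂ hc using hex
  set D : ℕ → Set (List Bool) := fun n => code k n (delta k n) m φ (A n) (c₁ n) (c₂ n) with hD
  set r : ℕ → ℝ := fun n => redundancy n (D n) with hr
  have hne : ∀ n, 2 ≤ n → (D n).Nonempty := by
    intro n hn
    by_contra hemp
    have h1 := hc n hn
    rw [Set.not_nonempty_iff_eq_empty] at hemp
    simp only [hD] at hemp
    rw [hemp, Set.ncard_empty, Nat.cast_zero, mul_zero] at h1
    exact absurd h1 (not_le.2 (by positivity))
  have hcor : ∀ n, Corrects k (D n) := fun n => corrects_code hk hφ n _ _ _ _ (hA n)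
  have hlen : ∀ n, ∀ x ∈ D n, x.length = n := fun n x hx => hx.1
  have hlow : ∀ n : ℕ, 2 ≤ n → Real.logb 2 n ≤ optRedundancy k n := by
    intro n hn
    refine le_csInf ⟨_, D n, hne n hn, hlen n, hcor n, rfl⟩ ?_
    rintro _ ⟨E, hE1, hE2, hE3, rfl⟩
    refine le_trans ?_ (logb_le_redundancy hk hE1 hE2 hE3)
    exact Real.logb_le_logb_of_le (by norm_num) (by positivity) (by linarith)
  have hopt : ∀ n, 2 ≤ n → optRedundancy k n ≤ r n := by
    intro n hn
    refine csInf_le ⟨Real.logb 2 (n + 1), ?_⟩ ⟨D n, hne n hn, hlen n, hcor n, rfl⟩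
    rintro _ ⟨E, hE1, hE2, hE3, rfl⟩
    exact logb_le_redundancy hk hE1 hE2 hE3
  obtain ⟨a, b, hm⟩ := exists_hash_length_le hk hφ (windowConst_pos k) hA hA'
  have hup : ∀ᶠ n : ℕ in atTop, r n - Real.logb 2 n ≤
      (Real.logb 2 (200000 * C k * C k * k) + 2 * a) +
        2 * b * Real.logb 2 (Real.logb 2 (n : ℝ)) := by
    filter_upwards [hm, eventually_ge_atTop 2] with n h1 h2
    have h3 := redundancy_le_of_large hk h2 (hc n h2)
    simp only [hr, redundancy]
    linarith
  have hO2 : (fun n : ℕ => r n - optRedundancy k n) =O[atTop]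
      fun n : ℕ => Real.logb 2 (Real.logb 2 (n : ℝ)) := by
    refine isBigO_of_le_add_mul
      (a := Real.logb 2 (200000 * C k * C k * k) + 2 * a) (b := 2 * b) tendsto_logb_logb ?_ ?_
    · filter_upwards [eventually_ge_atTop 2] with n hn
      linarith [hopt n hn]
    · filter_upwards [hup, eventually_ge_atTop 2] with n h1 hn
      linarith [hlow n hn]
  refine ⟨c₁, c₂, r, fun n => rfl, ?_, hO2, ?_⟩
  · refine isBigO_of_le_add_mul
      (a := Real.logb 2 (200000 * C k * C k * k) + 2 * a) (b := 2 * b) tendsto_logb_logb ?_ hup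
    filter_upwards [eventually_ge_atTop 2] with n hn
    linarith [hopt n hn, hlow n hn]
  · have h1 : (fun n : ℕ => Real.logb 2 (n : ℝ)) =O[atTop] fun n => optRedundancy k n := by
      refine IsBigO.of_bound 1 ?_
      filter_upwards [eventually_ge_atTop 2] with n hn
      have h2 : 0 ≤ Real.logb 2 (n : ℝ) :=
        Real.logb_nonneg (by norm_num) (by exact_mod_cast (by omega : 1 ≤ n))
      rw [Real.norm_of_nonneg h2, Real.norm_of_nonneg (h2.trans (hlow n hn)), one_mul]
      exact hlow n hn
    -- The ratio is `1 + (r - ρ) / ρ`, and `r - ρ = O(log log n)` is negligible against `ρ ≥ log n`.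
    have h2 := ((hO2.trans_isLittleO logb_logb_isLittleO).trans_isBigO h1).tendsto_div_nhds_zero
    have h3 := h2.const_add 1
    rw [add_zero] at h3
    refine h3.congr' ?_
    filter_upwards [eventually_ge_atTop 2] with n hn
    have h4 : 0 < Real.logb 2 (n : ℝ) :=
      Real.logb_pos (by norm_num) (by exact_mod_cast (by omega : 1 < n))
    have h5 : optRedundancy k n ≠ 0 := (h4.trans_le (hlow n hn)).ne'
    field_simp
    ring

end EditCode

theorem theorem1 (k : ℕ) (hk : 1 ≤ k) :
    -- the hashes that enter the construction exist
    (∃ (m : ℕ → ℕ) (φ : ℕ → List Bool → ℕ), EditCode.IsEditHash k m φ) ∧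
    -- the constant hidden in the block length `O(δ²)` depends on `k` only
    ∃ K₀ : ℝ, 0 < K₀ ∧
      ∀ (m : ℕ → ℕ) (φ : ℕ → List Bool → ℕ), EditCode.IsEditHash k m φ →
        -- the code corrects one `k`-substring edit
        (∀ (n : ℕ) (δ : ℝ) (A : ℕ) (c₁ : ℕ × ℕ × ℕ) (c₂ : ℕ × ℕ), K₀ * δ ^ 2 ≤ (A : ℝ) →
          EditCode.Corrects k (EditCode.code k n δ m φ A c₁ c₂)) ∧
        -- its redundancy for `δ = k 2^{2k+3} log n` and suitable hash values
        (∀ A : ℕ → ℕ, (∀ n : ℕ, K₀ * EditCode.delta k n ^ 2 ≤ (A n : ℝ)) →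
          ((fun n : ℕ => (A n : ℝ)) =O[atTop] fun n : ℕ => EditCode.delta k n ^ 2) →
          ∃ (c₁ : ℕ → ℕ × ℕ × ℕ) (c₂ : ℕ → ℕ × ℕ) (r : ℕ → ℝ),
            (∀ n : ℕ, r n = EditCode.redundancy n
              (EditCode.code k n (EditCode.delta k n) m φ (A n) (c₁ n) (c₂ n))) ∧
            ((fun n : ℕ => r n - Real.logb 2 (n : ℝ)) =O[atTop]
              fun n : ℕ => Real.logb 2 (Real.logb 2 (n : ℝ))) ∧
            -- asymptotic optimality
            ((fun n : ℕ => r n - EditCode.optRedundancy k n) =O[atTop]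
              fun n : ℕ => Real.logb 2 (Real.logb 2 (n : ℝ))) ∧
            Tendsto (fun n : ℕ => r n / EditCode.optRedundancy k n) atTop (nhds 1)) := by
  refine ⟨EditCode.exists_isEditHash hk, EditCode.windowConst k, EditCode.windowConst_pos k, ?_⟩
  intro m φ hφ
  exact ⟨fun n δ A c₁ c₂ hA => EditCode.corrects_code hk hφ n δ A c₁ c₂ hA,
    fun A hA hA' => EditCode.redundancy_asymptotics hk hφ hA hA'⟩
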